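/- Let $n\ge 2$, $1<p<\infty$, $0<\alpha\le 1$, and let $\Omega\subset\mathbb R^n$ be a bounded convex domain of class $C^{2,\alpha}_+$ (its boundary is of class $C^{2,\alpha}$ and its Gauss map $\partial\Omega\to\mathbb S^{n-1}$ is a diffeomorphism), with support function $h(y)=\sup_{x\in\Omega}\langle x,y\rangle$. Let $N_0$ be an open neighbourhood of $\partial\Omega$ and let $u\in W^{1,p}(\Omega\cap N_0)$ be continuous on $\bar\Omega\cap N_0$, positive and weakly $p$-harmonic in $\Omega\cap N_0$, with $u=0$ on $\partial\Omega$. Let $N$ be an open neighbourhood of $\partial\Omega$ with $\bar N\subset N_0$. For small $|t|$ let $\Omega^t$ be the convex domain with support function $h+th$, and let $u(\cdot,t)\in W^{1,p}(\Omega^t\cap N)\cap C(\overline{\Omega^t\cap N})$ be the weak solution of the Dirichlet problem $$\operatorname{div}\big(|\nabla u(\cdot,t)|^{p-2}\nabla u(\cdot,t)\big)=0\ \text{ in }\Omega^t\cap N,\qquad u(x,t)=0\ \text{ on }\partial\Omega^t\cap N,\qquad u(x,t)=u\big(\tfrac{x}{1+t}\big)\ \text{ on }\partial N\cap\Omega^t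 .$$ For $\xi\in\mathbb S^{n-1}$ let $$\mathscr F[h+th](\xi)=\big|\nabla u(\nabla(h+th)(\xi),t)\big|^{p-1}\det\big(\nabla^2_{\mathbb S^{n-1}}(h+th)(\xi)+(h+th)(\xi)\,\mathbb I\big),$$ the density on $\mathbb S^{n-1}$ of the image of the $p$-harmonic measure $|\nabla u(\cdot,t)|^{p-1}d\mathcal H^{n-1}|_{\partial\Omega^t}$ under the Gauss map. Here $\nabla(h+th)$ is the gradient of the $1$-homogeneous support function, $\nabla^2_{\mathbb S^{n-1}}$ is the covariant Hessian on the sphere, and the gradient of $u(\cdot,t)$ at a boundary point is taken from within $\overline{\Omega^t}$. Let $\mathscr F[h]$ be the same expression with $t=0$ and with $u$ itself, and let $\mathscr L_h[h]=\frac{d}{dt}\big|_{t=0}\mathscr F[h+th]$. Then there is $\tau\in(0,1)$ such that for all $|t|\le\tau$ we have $\partial\Omega^t\subset N$ and $\partial N\cap\Omega^t=\partial N\cap\Omega$, the Dirichlet problem has a solution, and (for whichever solution is used in its definition) $$\mathscr F[(1+t)h]=(1+t)^{n-p}\,\mathscr F[h]\quad\text{on }\mathbb S^{n-1}.$$ Moreover,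 for every $\xi\in\mathbb S^{n-1}$ the function $t\mapsto\mathscr F[h+th](\xi)$ is differentiable at $t=0$, and $$\mathscr L_h[h]=(n-p)\,\mathscr F[h]\quad\text{on }\mathbb S^{n-1}.$$ -/

import Mathlib

open MeasureTheory Set Filter Topology
open scoped ContDiff

namespace PHarmonicMinkowski

/-- The Euclidean space `ℝⁿ`. -/
abbrev E (n : ℕ) : Type := EuclideanSpace ℝ (Fin n)

variable {n : ℕ}

/-! ### Convex geometry -/

/-- The support function `h_A(y) = sup {⟨x, y⟩ : x ∈ A}`. -/
noncomputable def supportFn (A : Set (E n)) (y : E n) : ℝ :=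
  sSup ((fun x => inner ℝ x y) '' A)

/-- The open convex set with closure `{x : ⟨x, ξ⟩ ≤ f ξ for all unit ξ}`. For `f = h_Ω + t h_{Ω₀}`
this is the domain `Ω^t = Ω + t Ω₀`, which is described in this way for negative `t` as well. -/
def wulffDomain (f : E n → ℝ) : Set (E n) :=
  interior {x | ∀ ξ : E n, ‖ξ‖ = 1 → inner ℝ x ξ ≤ f ξ}

/-- The set of all outer unit normals of `Ω` at `x`. -/
def normals (Ω : Set (E n)) (x : E n) : Set (E n) :=
  {ξ | ‖ξ‖ = 1 ∧ ∀ y ∈ Ω, inner ℝ (y - x) ξ ≤ 0}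

/-- The boundary of `Ω` is of class `C^{2,α}`: near each of its points, and in coordinates
`x = x' + x₀ ν` with `ν` a unit vector and `x' ⟂ ν`, the set `Ω` is the epigraph `φ(x') < x₀` of a
function `φ` of class `C^{2,α}`. -/
def IsC2AlphaBoundary (α : ℝ) (Ω : Set (E n)) : Prop :=
  ∀ x ∈ frontier Ω, ∃ U : Set (E n), IsOpen U ∧ x ∈ U ∧
    ∃ ν : E n, ‖ν‖ = 1 ∧ ∃ φ : (ℝ ∙ ν)ᗮ → ℝ,
      ContDiff ℝ 2 φ ∧
      (∃ C : ℝ, ∀ y z,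
        ‖iteratedFDeriv ℝ 2 φ y - iteratedFDeriv ℝ 2 φ z‖ ≤ C * ‖y - z‖ ^ α) ∧
      (∀ y ∈ U, y ∈ Ω ↔ φ ((ℝ ∙ ν)ᗮ.orthogonalProjectionOnto y) < inner ℝ y ν) ∧
      (∀ y ∈ U, y ∈ frontier Ω ↔ φ ((ℝ ∙ ν)ᗮ.orthogonalProjectionOnto y) = inner ℝ y ν)

/-- Bounded convex domains of class `C^{2,α}_+`: the boundary is of class `C^{2,α}` and the Gauss
map `g`, which sends a boundary point to its outer unit normal, is a (`C¹`) diffeomorphism from the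
boundary onto the unit sphere. -/
structure IsC2AlphaPlusDomain (α : ℝ) (Ω : Set (E n)) : Prop where
  isOpen : IsOpen Ω
  convex : Convex ℝ Ω
  nonempty : Ω.Nonempty
  isBounded : Bornology.IsBounded Ω
  boundary : IsC2AlphaBoundary α Ω
  gauss : ∃ g ginv : E n → E n,
    (∀ x ∈ frontier Ω, normals Ω x = {g x}) ∧
    MapsTo g (frontier Ω) (Metric.sphere 0 1) ∧ MapsTo ginv (Metric.sphere 0 1) (frontier Ω) ∧
    InvOn ginv g (frontier Ω) (Metric.sphere 0 1) ∧
    ContDiffOn ℝ 1 g (frontier Ω) ∧ ContDiffOn ℝ 1 ginv (Metric.sphere 0 1)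

/-- The inverse of the chart of the sphere around `ξ` given by orthogonal projection to the tangent
space `T_ξ = ξ^⟂`: `z ↦ ∑ᵢ zᵢ eⁱ + √(1 - |z|²) ξ`, where `eⁱ` is an orthonormal basis of `T_ξ`. -/
noncomputable def sphereChart (ξ : E n) (z : E (Module.finrank ℝ (ℝ ∙ ξ)ᗮ)) : E n :=
  ∑ i, z i • (stdOrthonormalBasis ℝ (ℝ ∙ ξ)ᗮ i : E n) + Real.sqrt (1 - ‖z‖ ^ 2) • ξ

/-- `det (∇² f(ξ) + f(ξ) I)`, where the entries of the covariant Hessian `∇² f(ξ)` are the second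
partial derivatives of `f` at the centre `0` of the chart `sphereChart ξ`. -/
noncomputable def detHess (f : E n → ℝ) (ξ : E n) : ℝ :=
  Matrix.det (Matrix.of fun i j =>
    fderiv ℝ (fun y => fderiv ℝ (fun z => f (sphereChart ξ z)) y (EuclideanSpace.single j 1)) 0
        (EuclideanSpace.single i 1)
      + if i = j then f ξ else 0)

/-! ### Weak solutions of the `p`-Laplace equation -/

/-- `φ ∈ C_c^∞(U)`. -/
structure IsTestFunction (U : Set (E n)) (φ : E n → ℝ) : Prop where
  smooth : ContDiff ℝ ∞ φ
  compact : HasCompactSupport φ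
  support : tsupport φ ⊆ U

/-- `G` is the weak gradient of `u` on the open set `U`. -/
def IsWeakGradient (U : Set (E n)) (u : E n → ℝ) (G : E n → E n) : Prop :=
  ∀ φ : E n → ℝ, IsTestFunction U φ → ∀ e : E n,
    ∫ x in U, u x * fderiv ℝ φ x e = - ∫ x in U, inner ℝ (G x) e * φ x

/-- `u ∈ W^{1,p}(U)` and `div (|∇u|^{p-2} ∇u) = 0` weakly in `U`. -/
def IsWeakPHarmonic (p : ℝ) (U : Set (E n)) (u : E n → ℝ) : Prop :=
  ∃ G : E n → E n,
    MemLp u (ENNReal.ofReal p) (volume.restrict U) ∧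
    MemLp G (ENNReal.ofReal p) (volume.restrict U) ∧
    IsWeakGradient U u G ∧
    ∀ φ : E n → ℝ, IsTestFunction U φ →
      ∫ x in U, ‖G x‖ ^ (p - 2) * fderiv ℝ φ x (G x) = 0

/-- The function `u` which generates the `p`-harmonic measure of `Ω`: it is positive and
`p`-harmonic in the part of `Ω` inside a neighbourhood `N₀` of `∂Ω`, and vanishes continuously
on `∂Ω`. -/
structure IsPotential (p : ℝ) (Ω N₀ : Set (E n)) (u : E n → ℝ) : Prop where
  pharmonic : IsWeakPHarmonic p (Ω ∩ N₀) u
  continuousOn : ContinuousOn u (closure Ω ∩ N₀)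
  pos : ∀ x ∈ Ω ∩ N₀, 0 < u x
  zero : ∀ x ∈ frontier Ω, u x = 0

/-- `w` (in its continuous version) is a weak solution in `W^{1,p}(Ω^t ∩ N)` of the Dirichlet problem
`div (|∇w|^{p-2} ∇w) = 0` in `Ω^t ∩ N`, `w = 0` on `∂Ω^t ∩ N`, `w(x) = u(x / (1 + t))` on
`∂N ∩ Ω^t`, where `Ω^t` is the domain with support function `f`. -/
structure IsDirichletSolution (p : ℝ) (N : Set (E n)) (u : E n → ℝ) (f : E n → ℝ) (t : ℝ)
    (w : E n → ℝ) : Prop where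
  pharmonic : IsWeakPHarmonic p (wulffDomain f ∩ N) w
  continuousOn : ContinuousOn w (closure (wulffDomain f ∩ N))
  zero : ∀ x ∈ frontier (wulffDomain f) ∩ N, w x = 0
  outer : ∀ x ∈ frontier N ∩ wulffDomain f, w x = u ((1 + t)⁻¹ • x)

/-! ### The density of the `p`-harmonic measure on the sphere and its first variation -/

/-- The density `ℱ[f](ξ) = |∇w(∇f(ξ))|^{p-1} det (∇² f(ξ) + f(ξ) I)` of the image under the Gauss map
of the `p`-harmonic measure `|∇w|^{p-1} dℋ^{n-1}` of the domain with support function `f`. At the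
boundary point `∇f(ξ)` the gradient of `w` is the one taken from within the closed domain. -/
noncomputable def density (p : ℝ) (w : E n → ℝ) (f : E n → ℝ) (ξ : E n) : ℝ :=
  ‖gradientWithin w (closure (wulffDomain f)) (gradient f ξ)‖ ^ (p - 1) * detHess f ξ

/-- The first variation `ℒ_h[v](ξ) = d/dt|_{t=0} ℱ[h + t v](ξ)`, where `U t` is the function
`u(·, t)` on the domain with support function `h + t v`. -/
noncomputable def firstVariation (p : ℝ) (U : ℝ → E n → ℝ) (h v : E n → ℝ) (ξ : E n) : ℝ :=
  deriv (fun t : ℝ => density p (U t) (h + t • v) ξ) 0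

end PHarmonicMinkowski

open PHarmonicMinkowski

/-! The domain with support function `(1 + t) h` is the dilate `(1 + t) Ω`, and the `p`-Laplace
equation is invariant under dilations, so `x ↦ u (x / (1 + t))` solves the Dirichlet problem there.
By uniqueness it agrees with every other solution. The density then scales: the gradient contributes
`(1 + t) ^ (-(p - 1))` and the determinant of size `n - 1` contributes `(1 + t) ^ (n - 1)`
(`density_const_smul`). Differentiating `(1 + t) ^ (n - p)` at `0` gives the first variation.

The main work is uniqueness (`IsWeakPHarmonic.le_of_eq_on_frontier`), because boundary values are
attained only continuously and the difference `v` of two solutions is not itself an admissible test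
function. It is truncated by a smooth `η` vanishing below `ε`, and `η (v)` is approximated by
applying `η` to mollifications of `v` (`exists_testFunction_tendsto`). Strict monotonicity of `a ↦
|a|^{p-2} a` forces `η'(v) ∇v = 0` almost everywhere. Integration by parts against a linear function
turns this into `∫ η (v) = 0`, hence `v ≤ ε`.

No boundary regularity is needed: `gradientWithin` scales correctly whether or not the derivative
exists. -/

namespace PHarmonicMinkowski

/-! ### Convergence of mollifications in `L^p` -/

section Mollification

open scoped ENNReal Convolution
open ContinuousLinearMap (lsmul)

variable {X F : Type*} [NormedAddCommGroup X] [NormedSpace ℝ X] [FiniteDimensional ℝ X]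
  [MeasurableSpace X] [BorelSpace X] {μ : Measure X} [μ.IsAddHaarMeasure]
  [NormedAddCommGroup F]

/-- Translations act continuously on `L^p`. -/
theorem exists_eLpNorm_translate_sub_le {p : ℝ≥0∞} (hp1 : 1 ≤ p) (hp : p ≠ ⊤) {f : X → F}
    (hf : MemLp f p μ) {ε : ℝ≥0∞} (hε : 0 < ε) :
    ∃ δ > 0, ∀ c : X, ‖c‖ < δ → eLpNorm (fun x => f (c + x) - f x) p μ ≤ ε := by
  have := FiniteDimensional.proper_real X
  have : Fact (1 ≤ p) := ⟨hp1⟩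
  have : Fact (p ≠ ⊤) := ⟨hp⟩
  -- Strong continuity of translations is the continuity of the additive action of `X` on `Lp`, read
  -- along one orbit.
  have hc : Continuous fun c : X => DomAddAct.mk c +ᵥ hf.toLp f :=
    (DomAddAct.continuous_mk).vadd continuous_const
  have h0 := hc.tendsto 0
  rw [EMetric.tendsto_nhds] at h0
  obtain ⟨δ, hδ, hball⟩ := Metric.eventually_nhds_iff.1 (h0 ε hε)
  refine ⟨δ, hδ, fun c hcδ => ?_⟩
  have h1 := (hball (y := c) (by simpa using hcδ)).le
  rw [DomAddAct.mk_vadd_toLp, DomAddAct.mk_vadd_toLp, Lp.edist_toLp_toLp] at h1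
  simpa [Pi.sub_def] using h1

variable [NormedSpace ℝ F]

/-- Since `ρ` has mass one, `f x` can be moved under the integral. The measure with density `ρ` is
the probability measure to which Jensen's inequality is applied next. -/
theorem enorm_convolution_sub_le_lintegral {ρ : X → ℝ} (hρ : Continuous ρ)
    (hρc : HasCompactSupport ρ) (hρ0 : ∀ x, 0 ≤ ρ x) (hρ1 : ∫ x, ρ x ∂μ = 1) {f : X → F}
    (hf : LocallyIntegrable f μ) [CompleteSpace F] (x : X) :
    ‖(ρ ⋆[lsmul ℝ ℝ, μ] f) x - f x‖ₑ ≤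
      ∫⁻ t, ‖f (x - t) - f x‖ₑ ∂(μ.withDensity fun t => ENNReal.ofReal (ρ t)) := by
  have hint : Integrable (fun t => ρ t • f (x - t)) μ :=
    hρc.convolutionExists_left (lsmul ℝ ℝ) hρ hf x
  have hint2 : Integrable (fun t => ρ t • f x) μ :=
    (hρ.integrable_of_hasCompactSupport hρc).smul_const _
  have heq : (ρ ⋆[lsmul ℝ ℝ, μ] f) x - f x = ∫ t, ρ t • (f (x - t) - f x) ∂μ := by
    simp_rw [smul_sub]
    rw [integral_sub hint hint2, integral_smul_const, hρ1, one_smul]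
    rfl
  rw [heq, lintegral_withDensity_eq_lintegral_mul_non_measurable _
    hρ.measurable.ennreal_ofReal (by simp)]
  refine (enorm_integral_le_lintegral_enorm _).trans (le_of_eq (lintegral_congr fun t => ?_))
  simp [enorm_smul, Real.enorm_eq_ofReal (hρ0 t)]

/-- Jensen's inequality followed by Tonelli. Strong measurability of `f` itself makes `(x, t) ↦ f (x
- t) - f x` jointly measurable. -/
theorem eLpNorm_convolution_sub_le_of_stronglyMeasurable {p : ℝ≥0∞} (hp1 : 1 ≤ p) (hp : p ≠ ⊤)
    {ρ : X → ℝ} (hρ : Continuous ρ) (hρc : HasCompactSupport ρ) (hρ0 : ∀ x, 0 ≤ ρ x)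
    (hρ1 : ∫ x, ρ x ∂μ = 1) {f : X → F} [CompleteSpace F] (hfm : StronglyMeasurable f)
    (hf : MemLp f p μ) {ε : ℝ≥0∞}
    (hε : ∀ t ∈ Function.support ρ, eLpNorm (fun x => f (x - t) - f x) p μ ≤ ε) :
    eLpNorm (ρ ⋆[lsmul ℝ ℝ, μ] f - f) p μ ≤ ε := by
  set ν := μ.withDensity fun t => ENNReal.ofReal (ρ t) with hν
  have hprob : IsProbabilityMeasure ν := ⟨by
    rw [hν, withDensity_apply _ MeasurableSet.univ, Measure.restrict_univ,
      ← ofReal_integral_eq_lintegral_ofReal (hρ.integrable_of_hasCompactSupport hρc)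
        (Eventually.of_forall hρ0), hρ1, ENNReal.ofReal_one]⟩
  have hp0 : p ≠ 0 := (zero_lt_one.trans_le hp1).ne'
  have hpr : 0 < p.toReal := ENNReal.toReal_pos hp0 hp
  have hpow : ∀ g : X → F, eLpNorm g p μ ^ p.toReal = ∫⁻ x, ‖g x‖ₑ ^ p.toReal ∂μ := fun g => by
    rw [eLpNorm_eq_lintegral_rpow_enorm_toReal hp0 hp, ← ENNReal.rpow_mul,
      one_div, inv_mul_cancel₀ hpr.ne', ENNReal.rpow_one]
  have hmeas : StronglyMeasurable (fun z : X × X => f (z.1 - z.2) - f z.1) :=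
    (hfm.comp_measurable (measurable_fst.sub measurable_snd)).sub
      (hfm.comp_measurable measurable_fst)
  have hjensen : ∀ x, ‖(ρ ⋆[lsmul ℝ ℝ, μ] f) x - f x‖ₑ ^ p.toReal ≤
      ∫⁻ t, ‖f (x - t) - f x‖ₑ ^ p.toReal ∂ν := fun x => by
    have hm : AEStronglyMeasurable (fun t => f (x - t) - f x) ν :=
      (hmeas.comp_measurable measurable_prodMk_left).aestronglyMeasurable
    -- Jensen, in the form that `L^p` norms over a probability measure increase with the exponent.
    have h1 := eLpNorm_le_eLpNorm_of_exponent_le hp1 hm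
    rw [eLpNorm_one_eq_lintegral_enorm, eLpNorm_eq_lintegral_rpow_enorm_toReal hp0 hp] at h1
    have h2 := (enorm_convolution_sub_le_lintegral hρ hρc hρ0 hρ1
      (hf.locallyIntegrable hp1) x).trans h1
    have h3 := ENNReal.rpow_le_rpow h2 hpr.le
    rwa [← ENNReal.rpow_mul, one_div, inv_mul_cancel₀ hpr.ne', ENNReal.rpow_one] at h3
  rw [← ENNReal.rpow_le_rpow_iff hpr, hpow]
  calc ∫⁻ x, ‖(ρ ⋆[lsmul ℝ ℝ, μ] f - f) x‖ₑ ^ p.toReal ∂μ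
      ≤ ∫⁻ x, ∫⁻ t, ‖f (x - t) - f x‖ₑ ^ p.toReal ∂ν ∂μ := lintegral_mono hjensen
    _ = ∫⁻ t, ∫⁻ x, ‖f (x - t) - f x‖ₑ ^ p.toReal ∂μ ∂ν :=
        lintegral_lintegral_swap (hmeas.enorm.pow_const _).aemeasurable
    _ ≤ ∫⁻ _, ε ^ p.toReal ∂ν := by
        refine lintegral_mono_ae ?_
        rw [hν, ae_withDensity_iff hρ.measurable.ennreal_ofReal]
        refine Eventually.of_forall fun t ht => ?_
        rw [← hpow]
        refine ENNReal.rpow_le_rpow (hε t fun h0 => ht ?_) hpr.le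
        simp [h0]
    _ = ε ^ p.toReal := by simp

/-- Mollifications converge in `L^p`. -/
theorem tendsto_eLpNorm_convolution_sub {p : ℝ≥0∞} (hp1 : 1 ≤ p) (hp : p ≠ ⊤) {f : X → F}
    [CompleteSpace F] (hf : MemLp f p μ) {ι : Type*} {l : Filter ι} {φ : ι → ContDiffBump (0 : X)}
    (hφ : Tendsto (fun i => (φ i).rOut) l (𝓝 0)) :
    Tendsto (fun i => eLpNorm ((φ i).normed μ ⋆[lsmul ℝ ℝ, μ] f - f) p μ) l (𝓝 0) := by
  obtain ⟨g, hgm, hfg⟩ := hf.1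
  have hg : MemLp g p μ := hf.ae_eq hfg
  have hcongr : ∀ i, eLpNorm ((φ i).normed μ ⋆[lsmul ℝ ℝ, μ] f - f) p μ =
      eLpNorm ((φ i).normed μ ⋆[lsmul ℝ ℝ, μ] g - g) p μ := fun i => by
    rw [convolution_congr (lsmul ℝ ℝ) (EventuallyEq.refl _ _) hfg]
    exact eLpNorm_congr_ae (EventuallyEq.rfl.sub hfg)
  simp_rw [hcongr]
  rw [ENNReal.tendsto_nhds_zero]
  intro ε hε
  obtain ⟨δ, hδ, htr⟩ := exists_eLpNorm_translate_sub_le hp1 hp hg hε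
  filter_upwards [hφ.eventually (gt_mem_nhds hδ)] with i hi
  refine eLpNorm_convolution_sub_le_of_stronglyMeasurable hp1 hp (φ i).continuous_normed
    (φ i).hasCompactSupport_normed (φ i).nonneg_normed (φ i).integral_normed hgm hg fun t ht => ?_
  rw [(φ i).support_normed_eq] at ht
  have := htr (-t) (by rw [norm_neg]; exact (mem_ball_zero_iff.1 ht).trans hi)
  simpa [neg_add_eq_sub] using this

end Mollification

/-! ### Strict monotonicity of the `p`-Laplace flux -/

section Flux

variable {X : Type*} [NormedAddCommGroup X] [InnerProductSpace ℝ X]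

/-- The vector field `a ↦ |a|^{p-2} a` of the `p`-Laplace equation. -/
noncomputable def pFlux (p : ℝ) (a : X) : X := ‖a‖ ^ (p - 2) • a

theorem norm_pFlux {p : ℝ} (hp : 1 < p) (a : X) : ‖pFlux p a‖ = ‖a‖ ^ (p - 1) := by
  rcases eq_or_ne a 0 with rfl | ha
  · simp [pFlux, Real.zero_rpow (sub_pos.2 hp).ne']
  · have h0 : 0 < ‖a‖ := norm_pos_iff.2 ha
    rw [pFlux, norm_smul, Real.norm_of_nonneg (by positivity), ← Real.rpow_add_one h0.ne']
    congr 1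
    ring

/-- A radial and an angular term, both nonnegative; this treats all `p > 1` at once, without
separating `p < 2` from `p ≥ 2`. -/
theorem inner_pFlux_sub {p : ℝ} (hp : 1 < p) (a b : X) :
    inner ℝ (pFlux p a - pFlux p b) (a - b) =
      (‖a‖ ^ (p - 1) - ‖b‖ ^ (p - 1)) * (‖a‖ - ‖b‖) +
        (‖a‖ ^ (p - 2) + ‖b‖ ^ (p - 2)) * (‖a‖ * ‖b‖ - inner ℝ a b) := by
  have key : ∀ c : X, ‖c‖ ^ (p - 1) = ‖c‖ ^ (p - 2) * ‖c‖ := fun c => by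
    rw [← norm_pFlux hp, pFlux, norm_smul, Real.norm_of_nonneg (by positivity)]
  simp only [pFlux, inner_sub_left, inner_sub_right, real_inner_smul_left,
    real_inner_self_eq_norm_sq, real_inner_comm a b, key]
  ring

theorem rpow_sub_mul_sub_nonneg {q x y : ℝ} (hq : 0 ≤ q) (hx : 0 ≤ x) (hy : 0 ≤ y) :
    0 ≤ (x ^ q - y ^ q) * (x - y) := by
  rcases le_total x y with h | h
  · exact mul_nonneg_of_nonpos_of_nonpos
      (sub_nonpos.2 (Real.rpow_le_rpow hx h hq)) (sub_nonpos.2 h)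
  · exact mul_nonneg (sub_nonneg.2 (Real.rpow_le_rpow hy h hq)) (sub_nonneg.2 h)

theorem inner_pFlux_sub_nonneg {p : ℝ} (hp : 1 < p) (a b : X) :
    0 ≤ inner ℝ (pFlux p a - pFlux p b) (a - b) := by
  rw [inner_pFlux_sub hp]
  exact add_nonneg (rpow_sub_mul_sub_nonneg (by linarith) (norm_nonneg _) (norm_nonneg _))
    (mul_nonneg (by positivity) (sub_nonneg.2 (real_inner_le_norm a b)))

/-- The radial term forces equal norms, the angular one equality in Cauchy–Schwarz. -/
theorem eq_of_inner_pFlux_sub_eq_zero {p : ℝ} (hp : 1 < p) {a b : X}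
    (h : inner ℝ (pFlux p a - pFlux p b) (a - b) = 0) : a = b := by
  rw [inner_pFlux_sub hp] at h
  have h1 := rpow_sub_mul_sub_nonneg (q := p - 1) (by linarith) (norm_nonneg a) (norm_nonneg b)
  have h2 : 0 ≤ ‖a‖ * ‖b‖ - inner ℝ a b := sub_nonneg.2 (real_inner_le_norm a b)
  have h3 : 0 ≤ (‖a‖ ^ (p - 2) + ‖b‖ ^ (p - 2)) * (‖a‖ * ‖b‖ - inner ℝ a b) :=
    mul_nonneg (by positivity) h2
  have h4 : (‖a‖ ^ (p - 1) - ‖b‖ ^ (p - 1)) * (‖a‖ - ‖b‖) = 0 := by linarith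
  have hn : ‖a‖ = ‖b‖ := by
    rcases mul_eq_zero.1 h4 with h5 | h5
    · exact (Real.rpow_left_inj (norm_nonneg _) (norm_nonneg _) (sub_pos.2 hp).ne').1
        (sub_eq_zero.1 h5)
    · exact sub_eq_zero.1 h5
  -- For `b = 0` the angular weight may vanish, as `0 ^ (p - 2) = 0` for `p ≠ 2`.
  rcases eq_or_ne b 0 with rfl | hb
  · simpa using hn
  · have hb0 : 0 < ‖b‖ := norm_pos_iff.2 hb
    have h6 : ‖a‖ * ‖b‖ - inner ℝ a b = 0 := by
      have h7 : (‖a‖ ^ (p - 2) + ‖b‖ ^ (p - 2)) * (‖a‖ * ‖b‖ - inner ℝ a b) = 0 := by linarith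
      refine (mul_eq_zero.1 h7).resolve_left ?_
      rw [hn]
      positivity
    rw [← sub_eq_zero, ← norm_eq_zero, ← sq_eq_zero_iff, norm_sub_sq_real]
    rw [hn] at h6 ⊢
    linarith

/-- The norm of the flux is `‖G‖ ^ (p - 1)`, and `q = p / (p - 1)`. -/
theorem memLp_pFlux {Y : Type*} [MeasurableSpace Y] {μ : Measure Y} {p q : ℝ}
    (hpq : p.HolderConjugate q) {G : Y → X} (hG : MemLp G (ENNReal.ofReal p) μ) :
    MemLp (fun y => pFlux p (G y)) (ENNReal.ofReal q) μ := by
  have hp := hpq.lt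
  have h1 := hG.norm_rpow_div (ENNReal.ofReal (p - 1))
  rw [ENNReal.toReal_ofReal (by linarith), ← ENNReal.ofReal_div_of_pos (by linarith),
    ← hpq.conjugate_eq] at h1
  refine h1.of_le ?_ (Eventually.of_forall fun y => ?_)
  · exact (hG.1.norm.aemeasurable.pow_const (p - 2)).aestronglyMeasurable.smul hG.1
  · rw [norm_pFlux hp]
    exact le_abs_self _

end Flux

variable {n : ℕ}

/-! ### Test functions and weak gradients -/

theorem IsTestFunction.continuous_fderiv {U : Set (E n)} {φ : E n → ℝ} (hφ : IsTestFunction U φ) :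
    Continuous (fderiv ℝ φ) :=
  hφ.smooth.continuous_fderiv (by simp)

theorem IsTestFunction.exists_norm_le {U : Set (E n)} {φ : E n → ℝ} (hφ : IsTestFunction U φ) :
    ∃ C, ∀ x, ‖φ x‖ ≤ C :=
  hφ.compact.exists_bound_of_continuous hφ.smooth.continuous

theorem IsTestFunction.exists_norm_fderiv_le {U : Set (E n)} {φ : E n → ℝ}
    (hφ : IsTestFunction U φ) : ∃ C, ∀ x, ‖fderiv ℝ φ x‖ ≤ C :=
  (hφ.compact.fderiv ℝ).exists_bound_of_continuous hφ.continuous_fderiv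

theorem IsTestFunction.mono {U V : Set (E n)} {φ : E n → ℝ} (hφ : IsTestFunction U φ)
    (hUV : U ⊆ V) : IsTestFunction V φ :=
  ⟨hφ.smooth, hφ.compact, hφ.support.trans hUV⟩

theorem IsWeakGradient.sub {V : Set (E n)} {u₁ u₂ : E n → ℝ} {G₁ G₂ : E n → E n}
    (hu₁ : IntegrableOn u₁ V) (hu₂ : IntegrableOn u₂ V) (hG₁ : IntegrableOn G₁ V)
    (hG₂ : IntegrableOn G₂ V) (h₁ : IsWeakGradient V u₁ G₁) (h₂ : IsWeakGradient V u₂ G₂) :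
    IsWeakGradient V (u₁ - u₂) (G₁ - G₂) := by
  intro φ hφ e
  obtain ⟨C, hC⟩ := hφ.exists_norm_le
  obtain ⟨D, hD⟩ := hφ.exists_norm_fderiv_le
  have hI : ∀ u : E n → ℝ, IntegrableOn u V → IntegrableOn (fun x => u x * fderiv ℝ φ x e) V :=
    fun u hu => Integrable.mul_bdd (c := D * ‖e‖) hu
      (hφ.continuous_fderiv.clm_apply continuous_const).aestronglyMeasurable
      (Eventually.of_forall fun x => (ContinuousLinearMap.le_opNorm _ _).trans
        (mul_le_mul_of_nonneg_right (hD x) (norm_nonneg _)))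
  have hJ : ∀ G : E n → E n, IntegrableOn G V → IntegrableOn (fun x => inner ℝ (G x) e * φ x) V :=
    fun G hG => Integrable.mul_bdd (c := C) (hG.inner_const e)
      hφ.smooth.continuous.aestronglyMeasurable (Eventually.of_forall hC)
  simp only [Pi.sub_apply, sub_mul, inner_sub_left]
  rw [integral_sub (hI _ hu₁) (hI _ hu₂), integral_sub (hJ _ hG₁) (hJ _ hG₂), h₁ φ hφ e,
    h₂ φ hφ e]
  ring

/-! ### Approximation of truncations by test functions -/

section TestApproximation

open scoped Convolution
open ContinuousLinearMap (lsmul)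

/-- The translate and reflection of a bump function used as a test function. -/
theorem isTestFunction_normed_sub (ψ : ContDiffBump (0 : E n)) {V : Set (E n)} {x : E n}
    (hx : Metric.closedBall x ψ.rOut ⊆ V) :
    IsTestFunction V fun y => ψ.normed volume (x - y) := by
  have hsupp : tsupport (fun y => ψ.normed volume (x - y)) ⊆ Metric.closedBall x ψ.rOut := by
    refine closure_minimal (fun y hy => ?_) Metric.isClosed_closedBall
    have : x - y ∈ Function.support (ψ.normed (volume : Measure (E n))) := hy
    rw [ψ.support_normed_eq, mem_ball_zero_iff, ← dist_eq_norm] at this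
    rw [Metric.mem_closedBall, dist_comm]
    exact this.le
  refine ⟨ψ.contDiff_normed.comp (contDiff_const.sub contDiff_id), ?_, hsupp.trans hx⟩
  exact (isCompact_closedBall x ψ.rOut).of_isClosed_subset (isClosed_tsupport _) hsupp

/-- Mollification commutes with the weak gradient away from the boundary. -/
theorem fderiv_convolution_normed_apply (ψ : ContDiffBump (0 : E n)) {V : Set (E n)}
    (hV : MeasurableSet V) {v : E n → ℝ} {G : E n → E n} (hv : Continuous v)
    (hv0 : ∀ x ∉ V, v x = 0) (hG : LocallyIntegrable (V.indicator G) volume)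
    (hvG : IsWeakGradient V v G) {x : E n} (hx : Metric.closedBall x ψ.rOut ⊆ V) (e : E n) :
    fderiv ℝ (ψ.normed volume ⋆[lsmul ℝ ℝ, volume] v) x e =
      inner ℝ ((ψ.normed volume ⋆[lsmul ℝ ℝ, volume] V.indicator G) x) e := by
  set ρ := ψ.normed (volume : Measure (E n)) with hρ
  have hρd : Differentiable ℝ ρ := (ψ.contDiff_normed (n := 1)).differentiable (by simp)
  have hcont : Continuous (fderiv ℝ ρ) :=
    (ψ.contDiff_normed (n := 1)).continuous_fderiv (by simp)
  -- The kernel `y ↦ ρ (x - y)` is admissible in the weak gradient identity because its support, a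
  -- ball around `x`, lies in `V`.
  have htest : IsTestFunction V fun y => ρ (x - y) := isTestFunction_normed_sub ψ hx
  have hder : ∀ y, fderiv ℝ (fun y => ρ (x - y)) y e = -fderiv ℝ ρ (x - y) e := fun y => by
    have h := (hρd (x - y)).hasFDerivAt.comp y ((hasFDerivAt_id y).const_sub x)
    rw [show (fun y => ρ (x - y)) = ρ ∘ (x - ·) from rfl, h.fderiv]
    simp
  have h1 : HasFDerivAt (ρ ⋆[lsmul ℝ ℝ, volume] v) _ x :=
    ψ.hasCompactSupport_normed.hasFDerivAt_convolution_left (lsmul ℝ ℝ)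
      (ψ.contDiff_normed (n := 1)) hv.locallyIntegrable x
  rw [h1.fderiv]
  have hint : Integrable (fun t => ((lsmul ℝ ℝ).precompL (E n)) (fderiv ℝ ρ t) (v (x - t)))
      (volume : Measure (E n)) :=
    (ψ.hasCompactSupport_normed.fderiv ℝ).convolutionExists_left _ hcont hv.locallyIntegrable x
  rw [convolution_def, ContinuousLinearMap.integral_apply hint]
  have h2 : ∀ t, ((lsmul ℝ ℝ).precompL (E n)) (fderiv ℝ ρ t) (v (x - t)) e =
      fderiv ℝ ρ t e * v (x - t) := fun t => by
    simp [ContinuousLinearMap.precompL_apply]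
  simp_rw [h2]
  have h3 : ∫ t, fderiv ℝ ρ t e * v (x - t) = ∫ y, fderiv ℝ ρ (x - y) e * v y := by
    rw [← integral_sub_left_eq_self (fun t => fderiv ℝ ρ t e * v (x - t)) volume x]
    simp only [sub_sub_cancel]
  have h4 : ∫ y, fderiv ℝ ρ (x - y) e * v y = ∫ y in V, fderiv ℝ ρ (x - y) e * v y :=
    (setIntegral_eq_integral_of_forall_compl_eq_zero fun y hy => by simp [hv0 y hy]).symm
  have h5 := hvG _ htest e
  simp_rw [hder, mul_neg, integral_neg, neg_inj] at h5
  have hint2 : Integrable (fun t => ρ t • V.indicator G (x - t)) volume :=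
    ψ.hasCompactSupport_normed.convolutionExists_left (lsmul ℝ ℝ) ψ.continuous_normed hG x
  have h6 : inner ℝ ((ρ ⋆[lsmul ℝ ℝ, volume] V.indicator G) x) e =
      ∫ t, ρ t * inner ℝ (V.indicator G (x - t)) e := by
    rw [convolution_lsmul, real_inner_comm, ← integral_inner hint2]
    refine integral_congr_ae (Eventually.of_forall fun t => ?_)
    simp only [real_inner_smul_right, real_inner_comm]
  have h7 : ∫ t, ρ t * inner ℝ (V.indicator G (x - t)) e =
      ∫ y, ρ (x - y) * inner ℝ (V.indicator G y) e := by
    rw [← integral_sub_left_eq_self (fun t => ρ t * inner ℝ (V.indicator G (x - t)) e) volume x]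
    simp only [sub_sub_cancel]
  have h8 : ∫ y, ρ (x - y) * inner ℝ (V.indicator G y) e =
      ∫ y in V, inner ℝ (G y) e * ρ (x - y) := by
    rw [← integral_indicator hV]
    refine integral_congr_ae (Eventually.of_forall fun y => ?_)
    by_cases hy : y ∈ V <;> simp [hy, mul_comm]
  rw [h3, h4, h6, h7, h8, ← h5]
  simp_rw [mul_comm]

/-- A product of an `L^p` limit, an `L^q` function and a bounded pointwise limit. -/
theorem tendsto_integral_mul_inner {Y X : Type*} [MeasurableSpace Y] {μ : Measure Y}
    [NormedAddCommGroup X] [InnerProductSpace ℝ X] {p q : ENNReal} [p.HolderConjugate q]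
    {ι : Type*} {l : Filter ι} [l.IsCountablyGenerated] {a : ι → Y → ℝ} {a₀ : Y → ℝ}
    {g : ι → Y → X} {G F : Y → X} {B : ℝ} (ha : ∀ᶠ i in l, AEStronglyMeasurable (a i) μ)
    (haB : ∀ᶠ i in l, ∀ y, ‖a i y‖ ≤ B) (haa : ∀ y, Tendsto (fun i => a i y) l (𝓝 (a₀ y)))
    (hg : ∀ᶠ i in l, AEStronglyMeasurable (g i) μ)
    (hgG : Tendsto (fun i => eLpNorm (g i - G) p μ) l (𝓝 0)) (hG : MemLp G p μ)
    (hF : MemLp F q μ) :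
    Tendsto (fun i => ∫ y, a i y * inner ℝ (g i y) (F y) ∂μ) l
      (𝓝 (∫ y, a₀ y * inner ℝ (G y) (F y) ∂μ)) := by
  have hGF : Integrable (fun y => inner ℝ (G y) (F y)) μ := by
    rw [← memLp_one_iff_integrable]
    exact hG.of_bilin (fun x y => inner ℝ x y) 1 hF (hG.1.inner hF.1)
      (Eventually.of_forall fun y => by simpa using nnnorm_inner_le_nnnorm (𝕜 := ℝ) (G y) (F y))
  -- Write `g i = G + (g i - G)`: dominated convergence handles `G`, Hölder's inequality the error.
  have h1 : Tendsto (fun i => ∫ y, a i y * inner ℝ (G y) (F y) ∂μ) l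
      (𝓝 (∫ y, a₀ y * inner ℝ (G y) (F y) ∂μ)) := by
    refine tendsto_integral_filter_of_dominated_convergence
      (fun y => B * ‖inner ℝ (G y) (F y)‖) ?_ ?_ (hGF.norm.const_mul B) ?_
    · filter_upwards [ha] with i hi using hi.mul hGF.1
    · filter_upwards [haB] with i hi
      refine Eventually.of_forall fun y => ?_
      rw [norm_mul]
      exact mul_le_mul_of_nonneg_right (hi y) (norm_nonneg _)
    · exact Eventually.of_forall fun y => (haa y).mul_const _
  have hmem : ∀ᶠ i in l, MemLp (g i - G) p μ := by
    filter_upwards [hg, hgG.eventually (gt_mem_nhds ENNReal.zero_lt_top)] with i hi hi2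
    exact ⟨hi.sub hG.1, hi2⟩
  have h2 : Tendsto (fun i => ∫ y, a i y * inner ℝ (g i y - G y) (F y) ∂μ) l (𝓝 0) := by
    rw [tendsto_zero_iff_enorm_tendsto_zero]
    have hlim : Tendsto (fun i => (B.toNNReal : ENNReal) * (eLpNorm (g i - G) p μ * eLpNorm F q μ))
        l (𝓝 0) := by
      have := ENNReal.Tendsto.mul_const hgG (Or.inr hF.2.ne)
      rw [zero_mul] at this
      simpa using ENNReal.Tendsto.const_mul this (Or.inr (by simp : (B.toNNReal : ENNReal) ≠ ⊤))
    refine tendsto_of_tendsto_of_tendsto_of_le_of_le' tendsto_const_nhds hlim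
      (Eventually.of_forall fun _ => zero_le) ?_
    filter_upwards [haB, hmem] with i hi hm
    refine (enorm_integral_le_lintegral_enorm _).trans ?_
    have hH := eLpNorm_le_eLpNorm_mul_eLpNorm_of_nnnorm (p := p) (q := q) (r := 1) hm.1 hF.1
      (fun x y => inner ℝ x y) 1 (Eventually.of_forall fun y => by
        simpa using nnnorm_inner_le_nnnorm (𝕜 := ℝ) ((g i - G) y) (F y))
    rw [eLpNorm_one_eq_lintegral_enorm, ENNReal.coe_one, one_mul] at hH
    calc ∫⁻ y, ‖a i y * inner ℝ (g i y - G y) (F y)‖ₑ ∂μ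
        ≤ ∫⁻ y, B.toNNReal * ‖inner ℝ (g i y - G y) (F y)‖ₑ ∂μ := by
          refine lintegral_mono fun y => ?_
          rw [enorm_mul]
          gcongr
          rw [← ofReal_norm]
          exact ENNReal.ofReal_le_ofReal (hi y)
      _ = B.toNNReal * ∫⁻ y, ‖inner ℝ (g i y - G y) (F y)‖ₑ ∂μ :=
          lintegral_const_mul' _ _ (by simp)
      _ ≤ _ := by gcongr; exact hH
  have h3 := h2.add h1
  rw [zero_add] at h3
  refine h3.congr' ?_
  filter_upwards [ha, haB, hmem] with i hi hB hm
  have hI : Integrable (fun y => inner ℝ (g i y - G y) (F y)) μ := by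
    rw [← memLp_one_iff_integrable]
    exact hm.of_bilin (fun x y => inner ℝ x y) 1 hF (hm.1.inner hF.1)
      (Eventually.of_forall fun y => by
        simpa using nnnorm_inner_le_nnnorm (𝕜 := ℝ) (g i y - G y) (F y))
  rw [← integral_add (hI.bdd_mul hi (Eventually.of_forall hB))
    (hGF.bdd_mul hi (Eventually.of_forall hB))]
  refine integral_congr_ae (Eventually.of_forall fun y => ?_)
  simp only [inner_sub_left]
  ring

/-- Smooth truncations of a function with vanishing boundary values are limits of test functions,
together with their gradients. -/
theorem exists_testFunction_tendsto {V : Set (E n)} (hV : IsOpen V) (hVb : Bornology.IsBounded V)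
    {p q : ENNReal} [p.HolderConjugate q] (hp : p ≠ ⊤) {v : E n → ℝ} {G : E n → E n}
    (hv : Continuous v) (hv0 : ∀ x ∉ V, v x = 0) (hG : MemLp G p (volume.restrict V))
    (hvG : IsWeakGradient V v G) {η : ℝ → ℝ} (hη : ContDiff ℝ ∞ η) {ε : ℝ} (hε : 0 < ε)
    (hη0 : ∀ s ≤ ε, η s = 0) :
    ∃ φ : ℕ → E n → ℝ, (∀ᶠ k in atTop, IsTestFunction V (φ k)) ∧
      (∀ x, Tendsto (fun k => φ k x) atTop (𝓝 (η (v x)))) ∧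
      (∃ C, ∀ᶠ k in atTop, ∀ x, ‖φ k x‖ ≤ C) ∧
      ∀ F : E n → E n, MemLp F q (volume.restrict V) →
        Tendsto (fun k => ∫ x in V, fderiv ℝ (φ k) x (F x)) atTop
          (𝓝 (∫ x in V, deriv η (v x) * inner ℝ (G x) (F x))) := by
  have hp1 : 1 ≤ p := ENNReal.HolderConjugate.one_le p q
  let ψ : ℕ → ContDiffBump (0 : E n) := fun k =>
    ⟨1 / (2 * (k + 1)), 1 / (k + 1), by positivity, by
      apply one_div_lt_one_div_of_lt <;> [positivity; linarith [(k.cast_nonneg : (0 : ℝ) ≤ k)]]⟩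
  have hψ : Tendsto (fun k => (ψ k).rOut) atTop (𝓝 0) := tendsto_one_div_add_atTop_nhds_zero_nat
  set w : ℕ → E n → ℝ := fun k => (ψ k).normed volume ⋆[lsmul ℝ ℝ, volume] v with hw
  have hGi : MemLp (V.indicator G) p volume := (memLp_indicator_iff_restrict hV.measurableSet).2 hG
  have hGl : LocallyIntegrable (V.indicator G) volume := hGi.locallyIntegrable hp1
  have hvc : HasCompactSupport v := by
    refine HasCompactSupport.of_support_subset_isCompact hVb.isCompact_closure fun x hx => ?_
    by_contra h
    exact hx (hv0 x fun h' => h (subset_closure h'))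
  have hws : ∀ k, ContDiff ℝ ∞ (w k) := fun k =>
    (ψ k).hasCompactSupport_normed.contDiff_convolution_left _ (ψ k).contDiff_normed
      hv.locallyIntegrable
  have hunif : ∀ r > 0, ∀ᶠ k in atTop, ∀ x, dist (w k x) (v x) ≤ r := by
    intro r hr
    obtain ⟨δ, hδ, hδr⟩ := Metric.uniformContinuous_iff.1
      (hvc.uniformContinuous_of_continuous hv) r hr
    filter_upwards [hψ.eventually (gt_mem_nhds hδ)] with k hk x
    exact (ψ k).dist_normed_convolution_le hv.aestronglyMeasurable fun y hy =>
      (hδr ((Metric.mem_ball.1 hy).trans hk)).le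
  have hwlim : ∀ x, Tendsto (fun k => w k x) atTop (𝓝 (v x)) := fun x =>
    ContDiffBump.convolution_tendsto_right_of_continuous hψ hv x
  obtain ⟨M, hM⟩ := hvc.exists_bound_of_continuous hv
  have hwM : ∀ᶠ k in atTop, ∀ x, w k x ∈ Icc (-(M + 1)) (M + 1) := by
    filter_upwards [hunif 1 one_pos] with k hk x
    have h1 := hk x
    have h2 := hM x
    rw [Real.dist_eq, abs_le] at h1
    rw [Real.norm_eq_abs, abs_le] at h2
    constructor <;> linarith
  have hbdd : ∀ f : ℝ → ℝ, Continuous f → ∃ C, ∀ᶠ k in atTop, ∀ x, ‖f (w k x)‖ ≤ C :=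
    fun f hf => by
      obtain ⟨C, hC⟩ := (isCompact_Icc (a := -(M + 1)) (b := M + 1)).exists_bound_of_continuousOn
        hf.continuousOn
      exact ⟨C, hwM.mono fun k hk x => hC _ (hk x)⟩
  have hηd : Continuous (deriv η) := hη.continuous_deriv (by simp)
  have hηd0 : ∀ s < ε, deriv η s = 0 := fun s hs => by
    have : η =ᶠ[𝓝 s] fun _ => 0 := (gt_mem_nhds hs).mono fun y hy => hη0 y hy.le
    rw [this.deriv_eq, deriv_const]
  -- Off `K` one has `v < ε / 2`, so a mollification within `ε / 2` of `v` stays below `ε`, where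
  -- `η` vanishes. Hence all late approximants are supported in the compact set `K ⊆ V`.
  set K := {x | ε / 2 ≤ v x} with hK
  have hKc : IsClosed K := isClosed_le continuous_const hv
  have hKV : K ⊆ V := fun x hx => by
    by_contra h
    have : ε / 2 ≤ v x := hx
    rw [hv0 x h] at this
    linarith
  have hKcomp : IsCompact K := Metric.isCompact_of_isClosed_isBounded hKc (hVb.subset hKV)
  obtain ⟨δ, hδ, hδV⟩ := hKcomp.exists_cthickening_subset_open hV hKV
  have hsmall : ∀ᶠ k in atTop, ∀ x ∉ K, w k x < ε := by
    filter_upwards [hunif (ε / 2) (by positivity)] with k hk x hx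
    have h1 := hk x
    have h2 : v x < ε / 2 := not_le.1 hx
    rw [Real.dist_eq, abs_le] at h1
    linarith
  have htest : ∀ᶠ k in atTop, IsTestFunction V fun x => η (w k x) := by
    filter_upwards [hsmall] with k hk
    have hsupp : tsupport (fun x => η (w k x)) ⊆ K := by
      refine closure_minimal (fun x hx => ?_) hKc
      by_contra h
      exact hx (hη0 _ (hk x h).le)
    exact ⟨hη.comp (hws k), hKcomp.of_isClosed_subset (isClosed_tsupport _) hsupp,
      hsupp.trans hKV⟩
  refine ⟨fun k x => η (w k x), htest, fun x => (hη.continuous.tendsto _).comp (hwlim x),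
    hbdd η hη.continuous, fun F hF => ?_⟩
  obtain ⟨B, hB⟩ := hbdd _ hηd
  have hg : ∀ k, Continuous ((ψ k).normed volume ⋆[lsmul ℝ ℝ, volume] V.indicator G) := fun k =>
    ((ψ k).hasCompactSupport_normed.contDiff_convolution_left (n := 0) _ (ψ k).contDiff_normed
      hGl).continuous
  have hgG : Tendsto (fun k => eLpNorm ((ψ k).normed volume ⋆[lsmul ℝ ℝ, volume] V.indicator G - G)
      p (volume.restrict V)) atTop (𝓝 0) := by
    refine tendsto_of_tendsto_of_tendsto_of_le_of_le tendsto_const_nhds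
      (tendsto_eLpNorm_convolution_sub hp1 hp hGi hψ) (fun _ => zero_le) fun k => ?_
    refine le_trans (le_of_eq ?_) (eLpNorm_restrict_le _ _ _ V)
    refine eLpNorm_congr_ae ?_
    filter_upwards [ae_restrict_mem hV.measurableSet] with x hx
    simp [hx]
  have hmain := tendsto_integral_mul_inner (q := q) (a := fun k x => deriv η (w k x))
    (a₀ := fun x => deriv η (v x))
    (Eventually.of_forall fun k => (hηd.comp (hws k).continuous).aestronglyMeasurable) hB
    (fun x => (hηd.tendsto _).comp (hwlim x))
    (Eventually.of_forall fun k => (hg k).aestronglyMeasurable) hgG hG hF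
  refine hmain.congr' ?_
  filter_upwards [hsmall, hψ.eventually (gt_mem_nhds hδ)] with k hk hkδ
  refine integral_congr_ae (Eventually.of_forall fun x => ?_)
  have hchain : fderiv ℝ (fun x => η (w k x)) x = deriv η (w k x) • fderiv ℝ (w k) x :=
    (((hη.differentiable (by simp)) (w k x)).hasDerivAt.comp_hasFDerivAt x
      (((hws k).differentiable (by simp)) x).hasFDerivAt).fderiv
  simp only [hchain, smul_apply, smul_eq_mul]
  -- On `K` the mollification ball stays inside `V`, so the gradient commutes with mollification;
  -- off `K` the factor `η'` vanishes on both sides.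
  by_cases hx : x ∈ K
  · rw [hw, fderiv_convolution_normed_apply (ψ k) hV.measurableSet hv hv0 hGl hvG]
    exact ((Metric.closedBall_subset_closedBall hkδ.le).trans
      (Metric.closedBall_subset_cthickening hx δ)).trans hδV
  · rw [hηd0 _ (hk x hx), zero_mul, zero_mul]

end TestApproximation

/-! ### Comparison principle and uniqueness -/

section Uniqueness

theorem IsTestFunction.setIntegral_eq {V : Set (E n)} {φ : E n → ℝ} (hφ : IsTestFunction V φ) :
    ∫ x in V, φ x = ∫ x, φ x :=
  setIntegral_eq_integral_of_forall_compl_eq_zero fun _ hx =>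
    image_eq_zero_of_notMem_tsupport fun h => hx (hφ.support h)

theorem IsTestFunction.fderiv_eq_zero {V : Set (E n)} {φ : E n → ℝ} (hφ : IsTestFunction V φ)
    {x : E n} (hx : x ∉ V) : fderiv ℝ φ x = 0 :=
  image_eq_zero_of_notMem_tsupport fun h => hx (hφ.support (tsupport_fderiv_subset ℝ h))

/-- Integration by parts against `x ↦ ⟨e, x⟩` recovers `∫ φ` from the gradient alone; it plays the
role of a Poincaré inequality. -/
theorem IsTestFunction.integral_eq_neg {V : Set (E n)} {φ : E n → ℝ} (hφ : IsTestFunction V φ)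
    {e : E n} (he : ‖e‖ = 1) :
    ∫ x in V, φ x = -∫ x in V, fderiv ℝ φ x (inner ℝ e x • e) := by
  have hder : ∀ x : E n, fderiv ℝ (fun x : E n => inner ℝ e x) x e = 1 := fun x => by
    have : HasFDerivAt (fun x : E n => inner ℝ e x) (innerSL ℝ e) x := (innerSL ℝ e).hasFDerivAt
    rw [this.fderiv, innerSL_apply_apply, real_inner_self_eq_norm_sq, he, one_pow]
  have hc : Continuous fun x : E n => fderiv ℝ φ x e :=
    hφ.continuous_fderiv.clm_apply continuous_const
  have hcs : HasCompactSupport fun x : E n => fderiv ℝ φ x e :=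
    (hφ.compact.fderiv ℝ).comp_left (g := fun L : E n →L[ℝ] ℝ => L e) rfl
  have hin : Continuous fun x : E n => inner ℝ e x := by fun_prop
  have h := integral_mul_fderiv_eq_neg_fderiv_mul_of_integrable (μ := (volume : Measure (E n)))
    (f := fun x : E n => inner ℝ e x) (g := φ) (v := e)
    (by simpa [hder] using hφ.smooth.continuous.integrable_of_hasCompactSupport hφ.compact)
    ((hin.mul hc).integrable_of_hasCompactSupport hcs.mul_left)
    ((hin.mul hφ.smooth.continuous).integrable_of_hasCompactSupport hφ.compact.mul_left)
    (fun x _ => (innerSL ℝ e).differentiableAt)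
    (fun x _ => hφ.smooth.differentiable (by simp) x)
  simp only [hder, one_mul] at h
  rw [hφ.setIntegral_eq, setIntegral_eq_integral_of_forall_compl_eq_zero
    fun x hx => by rw [hφ.fderiv_eq_zero hx]; rfl]
  simp only [map_smul, smul_eq_mul, h, neg_neg]

theorem integrable_fderiv_apply {V : Set (E n)} {φ : E n → ℝ} (hφ : IsTestFunction V φ)
    {F : E n → E n} (hF : IntegrableOn F V) : IntegrableOn (fun x => fderiv ℝ φ x (F x)) V := by
  obtain ⟨D, hD⟩ := hφ.exists_norm_fderiv_le
  refine (hF.norm.const_mul D).mono' ?_ (Eventually.of_forall fun x =>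
    (ContinuousLinearMap.le_opNorm _ _).trans
      (mul_le_mul_of_nonneg_right (hD x) (norm_nonneg _)))
  exact isBoundedBilinearMap_apply.continuous.comp_aestronglyMeasurable
    (hφ.continuous_fderiv.aestronglyMeasurable.prodMk hF.1)

theorem eq_zero_of_setIntegral_eq_zero {V : Set (E n)} {f : E n → ℝ} (hf : Continuous f)
    (hfc : HasCompactSupport f) (hf0 : ∀ x, 0 ≤ f x) (hV : ∀ x ∉ V, f x = 0)
    (hint : ∫ x in V, f x = 0) (x : E n) : f x = 0 := by
  by_contra h
  rw [setIntegral_eq_integral_of_forall_compl_eq_zero hV] at hint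
  exact (hf.integral_pos_of_hasCompactSupport_nonneg_nonzero hfc hf0 h).ne' hint

/-- The comparison principle for the `p`-Laplace equation. -/
theorem IsWeakPHarmonic.le_of_eq_on_frontier (hn : 1 ≤ n) {p : ℝ} (hp : 1 < p) {V : Set (E n)}
    (hV : IsOpen V) (hVb : Bornology.IsBounded V) {w₁ w₂ : E n → ℝ}
    (h₁ : IsWeakPHarmonic p V w₁) (h₂ : IsWeakPHarmonic p V w₂)
    (hc₁ : ContinuousOn w₁ (closure V)) (hc₂ : ContinuousOn w₂ (closure V))
    (hfr : ∀ x ∈ frontier V, w₁ x = w₂ x) : ∀ x ∈ V, w₁ x ≤ w₂ x := by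
  obtain ⟨G₁, hw₁, hG₁, hwG₁, heq₁⟩ := h₁
  obtain ⟨G₂, hw₂, hG₂, hwG₂, heq₂⟩ := h₂
  set q := p.conjExponent
  have hpq : p.HolderConjugate q := Real.HolderConjugate.conjExponent hp
  have : (ENNReal.ofReal p).HolderConjugate (ENNReal.ofReal q) := hpq.ennrealOfReal
  have hp1 : 1 ≤ ENNReal.ofReal p := ENNReal.one_le_ofReal.2 hp.le
  have hq1 : 1 ≤ ENNReal.ofReal q := ENNReal.one_le_ofReal.2 hpq.symm.lt.le
  have : IsFiniteMeasure ((volume : Measure (E n)).restrict V) :=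
    ⟨by rw [Measure.restrict_apply_univ]; exact hVb.measure_lt_top⟩
  set v : E n → ℝ := V.indicator (w₁ - w₂) with hv
  -- Extension by zero is continuous because the two functions agree on the frontier.
  have hvc : Continuous v :=
    continuous_indicator (fun x hx => sub_eq_zero.2 (hfr x hx)) (hc₁.sub hc₂)
  have hv0 : ∀ x ∉ V, v x = 0 := fun x hx => indicator_of_notMem hx _
  have hvcs : HasCompactSupport v := by
    refine HasCompactSupport.of_support_subset_isCompact hVb.isCompact_closure fun x hx => ?_
    by_contra h
    exact hx (hv0 x fun h' => h (subset_closure h'))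
  have hG : MemLp (G₁ - G₂) (ENNReal.ofReal p) (volume.restrict V) := hG₁.sub hG₂
  have hvG : IsWeakGradient V v (G₁ - G₂) := by
    intro φ hφ e
    rw [← IsWeakGradient.sub (hw₁.integrable hp1) (hw₂.integrable hp1) (hG₁.integrable hp1)
      (hG₂.integrable hp1) hwG₁ hwG₂ φ hφ e]
    refine setIntegral_congr_fun hV.measurableSet fun x hx => ?_
    simp only [hv, indicator_of_mem hx]
  have hF₁ := memLp_pFlux hpq hG₁
  have hF₂ := memLp_pFlux hpq hG₂
  have hF := hF₁.sub hF₂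
  suffices hε : ∀ ε > 0, ∀ x, v x ≤ ε by
    intro x hx
    have := le_of_forall_pos_le_add fun ε h => (hε ε h x).trans (zero_add ε).ge
    rw [hv, indicator_of_mem hx] at this
    exact sub_nonpos.1 this
  intro ε hε
  -- Smooth, monotone, and zero exactly for `s ≤ ε`, so vanishing of `η (v)` gives back `v ≤ ε`.
  set η : ℝ → ℝ := fun s => expNegInvGlue (s - ε) with hη
  have hηs : ContDiff ℝ ∞ η := expNegInvGlue.contDiff.comp (contDiff_id.sub contDiff_const)
  have hηm : Monotone η := fun a b hab => expNegInvGlue.monotone (sub_le_sub_right hab ε)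
  have hη0 : ∀ s ≤ ε, η s = 0 := fun s hs => expNegInvGlue.zero_of_nonpos (sub_nonpos.2 hs)
  have hηd : Continuous (deriv η) := hηs.continuous_deriv (by simp)
  obtain ⟨φ, hφ, hφlim, ⟨C, hC⟩, hφF⟩ := exists_testFunction_tendsto
    (q := ENNReal.ofReal q) hV hVb ENNReal.ofReal_ne_top hvc hv0 hG hvG hηs hε hη0
  have hzero : ∀ᶠ k in atTop, ∫ x in V, fderiv ℝ (φ k) x (pFlux p (G₁ x) - pFlux p (G₂ x)) = 0 := by
    filter_upwards [hφ] with k hk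
    simp only [map_sub]
    rw [integral_sub (integrable_fderiv_apply hk (hF₁.integrable hq1))
      (integrable_fderiv_apply hk (hF₂.integrable hq1))]
    simp only [pFlux, map_smul, smul_eq_mul]
    rw [heq₁ _ hk, heq₂ _ hk, sub_zero]
  have hint : ∫ x in V, deriv η (v x) *
      inner ℝ ((G₁ - G₂) x) (pFlux p (G₁ x) - pFlux p (G₂ x)) = 0 :=
    tendsto_nhds_unique (hφF _ hF) (tendsto_const_nhds.congr' (hzero.mono fun _ h => h.symm))
  have hnonneg : ∀ x, 0 ≤ deriv η (v x) *
      inner ℝ ((G₁ - G₂) x) (pFlux p (G₁ x) - pFlux p (G₂ x)) := fun x => by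
    refine mul_nonneg hηm.deriv_nonneg ?_
    rw [real_inner_comm]
    exact inner_pFlux_sub_nonneg hp _ _
  have hintg : IntegrableOn (fun x => inner ℝ ((G₁ - G₂) x)
      (pFlux p (G₁ x) - pFlux p (G₂ x))) V := by
    rw [IntegrableOn, ← memLp_one_iff_integrable]
    exact hG.of_bilin (fun x y => inner ℝ x y) 1 hF (hG.1.inner hF.1)
      (Eventually.of_forall fun y => by simpa using nnnorm_inner_le_nnnorm (𝕜 := ℝ) _ _)
  obtain ⟨D, hD⟩ : ∃ D, ∀ x, ‖deriv η (v x)‖ ≤ D := by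
    obtain ⟨M, hM⟩ := hvcs.exists_bound_of_continuous hvc
    obtain ⟨D, hD⟩ := (isCompact_Icc (a := -M) (b := M)).exists_bound_of_continuousOn
      hηd.continuousOn
    exact ⟨D, fun x => hD _ (abs_le.1 (hM x))⟩
  have hintg' := Integrable.bdd_mul hintg
    (hηd.comp hvc).aestronglyMeasurable (Eventually.of_forall hD)
  have hae := (integral_eq_zero_iff_of_nonneg hnonneg hintg').1 hint
  obtain ⟨e, he⟩ : ∃ e : E n, ‖e‖ = 1 := ⟨EuclideanSpace.single ⟨0, hn⟩ 1, by simp⟩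
  have hFe : MemLp (fun x : E n => inner ℝ e x • e) (ENNReal.ofReal q) (volume.restrict V) := by
    obtain ⟨R, hR⟩ := hVb.exists_norm_le
    refine MemLp.of_bound (Continuous.aestronglyMeasurable (by fun_prop)) R ?_
    filter_upwards [ae_restrict_mem hV.measurableSet] with x hx
    rw [norm_smul, he, mul_one]
    exact (norm_inner_le_norm e x).trans (by rw [he, one_mul]; exact hR x hx)
  -- Almost everywhere either `η'(v) = 0` or the two weak gradients agree.
  have hlim0 : ∫ x in V, deriv η (v x) * inner ℝ ((G₁ - G₂) x) (inner ℝ e x • e) = 0 := by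
    refine integral_eq_zero_of_ae (hae.mono fun x hx => ?_)
    rcases mul_eq_zero.1 hx with h | h
    · simp [h]
    · have : G₁ x = G₂ x := eq_of_inner_pFlux_sub_eq_zero hp (by rwa [real_inner_comm])
      simp [this]
  have hlim1 := hφF _ hFe
  rw [hlim0] at hlim1
  have hlim2 : Tendsto (fun k => ∫ x in V, φ k x) atTop (𝓝 (∫ x in V, η (v x))) := by
    refine tendsto_integral_filter_of_dominated_convergence (fun _ => C) ?_ ?_
      (integrable_const C) (Eventually.of_forall hφlim)
    · exact hφ.mono fun k hk => hk.smooth.continuous.aestronglyMeasurable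
    · exact hC.mono fun k hk => Eventually.of_forall hk
  -- The limit of `∫ φ k` is computed twice: directly, and through the gradients after integration
  -- by parts.
  have hint0 : ∫ x in V, η (v x) = 0 := by
    refine tendsto_nhds_unique hlim2 ?_
    have := hlim1.neg
    rw [neg_zero] at this
    exact this.congr' (hφ.mono fun k hk => (hk.integral_eq_neg he).symm)
  have hfin := eq_zero_of_setIntegral_eq_zero (hηs.continuous.comp hvc)
    (hvcs.comp_left (hη0 0 hε.le)) (fun x => expNegInvGlue.nonneg _)
    (fun x hx => by simp only [Function.comp_apply, hv0 x hx, hη0 0 hε.le]) hint0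
  intro x
  exact sub_nonpos.1 (expNegInvGlue.zero_iff_nonpos.1 (hfin x))

/-- Uniqueness in the Dirichlet problem for the `p`-Laplace equation. -/
theorem IsWeakPHarmonic.eqOn_closure (hn : 1 ≤ n) {p : ℝ} (hp : 1 < p) {V : Set (E n)}
    (hV : IsOpen V) (hVb : Bornology.IsBounded V) {w₁ w₂ : E n → ℝ}
    (h₁ : IsWeakPHarmonic p V w₁) (h₂ : IsWeakPHarmonic p V w₂)
    (hc₁ : ContinuousOn w₁ (closure V)) (hc₂ : ContinuousOn w₂ (closure V))
    (hfr : ∀ x ∈ frontier V, w₁ x = w₂ x) : EqOn w₁ w₂ (closure V) := by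
  intro x hx
  by_cases hxV : x ∈ V
  · exact le_antisymm (h₁.le_of_eq_on_frontier hn hp hV hVb h₂ hc₁ hc₂ hfr x hxV)
      (h₂.le_of_eq_on_frontier hn hp hV hVb h₁ hc₂ hc₁ (fun y hy => (hfr y hy).symm) x hxV)
  · exact hfr x (by rw [hV.frontier_eq]; exact ⟨hx, hxV⟩)

end Uniqueness

/-! ### Behaviour under dilations -/

section Scaling

open scoped Pointwise

theorem IsWeakPHarmonic.mono {p : ℝ} {U V : Set (E n)} {u : E n → ℝ} (hV : MeasurableSet V)
    (hUV : U ⊆ V) (hu : IsWeakPHarmonic p V u) : IsWeakPHarmonic p U u := by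
  obtain ⟨G, hu, hG, hw, heq⟩ := hu
  have hle := Measure.restrict_mono hUV (le_refl (volume : Measure (E n)))
  refine ⟨G, hu.mono_measure hle, hG.mono_measure hle, fun φ hφ e => ?_, fun φ hφ => ?_⟩
  · have h := hw φ (hφ.mono hUV) e
    rwa [setIntegral_eq_of_subset_of_forall_sdiff_eq_zero hV hUV,
      setIntegral_eq_of_subset_of_forall_sdiff_eq_zero hV hUV] at h
    · intro x hx
      rw [image_eq_zero_of_notMem_tsupport fun h => hx.2 (hφ.support h), mul_zero]
    · intro x hx
      simp [hφ.fderiv_eq_zero hx.2]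
  · have h := heq φ (hφ.mono hUV)
    rwa [setIntegral_eq_of_subset_of_forall_sdiff_eq_zero hV hUV] at h
    intro x hx
    simp [hφ.fderiv_eq_zero hx.2]

theorem memLp_comp_inv_smul {F : Type*} [NormedAddCommGroup F] {p : ENNReal} {c : ℝ} (hc : 0 < c)
    {V : Set (E n)} (hV : MeasurableSet V) {f : E n → F} (hf : MemLp f p (volume.restrict V)) :
    MemLp (fun x => f (c⁻¹ • x)) p (volume.restrict (c • V)) := by
  refine MemLp.comp_of_map (f := fun x : E n => c⁻¹ • x) ?_ (by fun_prop)
  have hpre : (fun x : E n => c⁻¹ • x) ⁻¹' V = c • V := by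
    rw [preimage_smul_inv₀ hc.ne']
  rw [← hpre, ← Measure.restrict_map (by fun_prop) hV,
    Measure.map_addHaar_smul _ (inv_ne_zero hc.ne'), Measure.restrict_smul]
  exact hf.smul_measure ENNReal.ofReal_ne_top

theorem setIntegral_smul_set {c : ℝ} (hc : 0 < c) (V : Set (E n)) (f : E n → ℝ) :
    ∫ x in c • V, f x = c ^ Module.finrank ℝ (E n) * ∫ x in V, f (c • x) := by
  rw [Measure.setIntegral_comp_smul_of_pos volume f V hc, smul_eq_mul,
    mul_inv_cancel_left₀ (by positivity)]

theorem IsTestFunction.comp_smul {c : ℝ} (hc : c ≠ 0) {V : Set (E n)} {φ : E n → ℝ}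
    (hφ : IsTestFunction (c • V) φ) : IsTestFunction V fun x => φ (c • x) := by
  refine ⟨hφ.smooth.comp (contDiff_const_smul c), hφ.compact.comp_homeomorph
    (Homeomorph.smulOfNeZero c hc), fun x hx => ?_⟩
  have h1 := tsupport_comp_subset_preimage φ (continuous_const_smul c) hx
  exact (smul_mem_smul_set_iff₀ hc V x).1 (hφ.support h1)

/-- The `p`-Laplace equation is invariant under dilations. -/
theorem IsWeakPHarmonic.comp_inv_smul {p c : ℝ} (hc : 0 < c) {V : Set (E n)} {u : E n → ℝ}
    (hV : MeasurableSet V) (hu : IsWeakPHarmonic p V u) :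
    IsWeakPHarmonic p (c • V) fun x => u (c⁻¹ • x) := by
  obtain ⟨G, hu, hG, hw, heq⟩ := hu
  have hder : ∀ (φ : E n → ℝ) x e, fderiv ℝ φ (c • x) e =
      c⁻¹ * fderiv ℝ (fun x => φ (c • x)) x e := fun φ x e => by
    rw [fderiv_comp_smul, smul_apply, smul_eq_mul, inv_mul_cancel_left₀ hc.ne']
  refine ⟨fun x => c⁻¹ • G (c⁻¹ • x), memLp_comp_inv_smul hc hV hu,
    (memLp_comp_inv_smul hc hV hG).const_smul c⁻¹, fun φ hφ e => ?_, fun φ hφ => ?_⟩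
  · rw [setIntegral_smul_set hc, setIntegral_smul_set hc]
    simp only [inv_smul_smul₀ hc.ne', hder φ, real_inner_smul_left, mul_left_comm _ c⁻¹,
      mul_assoc, integral_const_mul]
    rw [hw _ (hφ.comp_smul hc.ne') e]
    ring
  · rw [setIntegral_smul_set hc]
    simp only [inv_smul_smul₀ hc.ne', hder φ, map_smul, smul_eq_mul, norm_smul,
      Real.mul_rpow (norm_nonneg _) (norm_nonneg _), mul_left_comm _ c⁻¹, mul_assoc,
      integral_const_mul]
    rw [heq _ (hφ.comp_smul hc.ne')]
    simp

theorem gradient_const_smul (c : ℝ) (f : E n → ℝ) (x : E n) :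
    gradient (c • f) x = c • gradient f x := by
  simp [gradient, fderiv_const_smul_field]

theorem gradientWithin_comp_inv_smul {c : ℝ} (hc : c ≠ 0) (u : E n → ℝ) {s : Set (E n)} {x : E n}
    (hs : UniqueDiffWithinAt ℝ s x) :
    gradientWithin (fun y => u (c⁻¹ • y)) (c • s) (c • x) = c⁻¹ • gradientWithin u s x := by
  have hs' : UniqueDiffWithinAt ℝ (c • s) (c • x) := hs.smul hc
  rw [gradientWithin, fderivWithin_comp_smul c⁻¹ hs', smul_smul, inv_mul_cancel₀ hc, one_smul,
    inv_smul_smul₀ hc, gradientWithin, map_smulₛₗ]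
  simp

theorem finrank_orthogonal_span_singleton_of_norm_eq_one {ξ : E n} (hξ : ‖ξ‖ = 1) :
    Module.finrank ℝ (ℝ ∙ ξ)ᗮ + 1 = n := by
  have h := Submodule.finrank_add_finrank_orthogonal (ℝ ∙ ξ)
  rw [finrank_span_singleton (norm_ne_zero_iff.1 (by rw [hξ]; exact one_ne_zero)),
    finrank_euclideanSpace_fin] at h
  omega

/-- The matrix is linear in `f` and its size is the dimension of `ξ^⟂`, which is `n - 1` for a unit
vector. -/
theorem detHess_const_smul (c : ℝ) (f : E n → ℝ) (ξ : E n) :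
    detHess (c • f) ξ = c ^ Module.finrank ℝ (ℝ ∙ ξ)ᗮ * detHess f ξ := by
  have h1 : ∀ (g : E (Module.finrank ℝ (ℝ ∙ ξ)ᗮ) → ℝ) x e,
      fderiv ℝ (fun z => c * g z) x e = c * fderiv ℝ g x e := fun g x e => by
    have := fderiv_const_smul_field (𝕜 := ℝ) (f := g) c
    have h2 := congr_fun this x
    rw [show (fun z => c * g z) = c • g from rfl, h2]
    rfl
  have hpow := Matrix.det_smul (Matrix.of fun i j : Fin (Module.finrank ℝ (ℝ ∙ ξ)ᗮ) =>
    fderiv ℝ (fun y => fderiv ℝ (fun z => f (sphereChart ξ z)) y (EuclideanSpace.single j 1)) 0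
        (EuclideanSpace.single i 1)
      + if i = j then f ξ else 0) c
  rw [Fintype.card_fin] at hpow
  rw [detHess, detHess, ← hpow]
  congr 1
  ext i j
  simp only [Matrix.of_apply, Matrix.smul_apply, Pi.smul_apply, smul_eq_mul, h1, mul_add, mul_ite,
    mul_zero]

end Scaling

/-! ### Support functions and their gradients -/

section SupportFunction

open scoped Pointwise

theorem inner_le_supportFn {A : Set (E n)} (hA : Bornology.IsBounded A) {x : E n}
    (hx : x ∈ closure A) (y : E n) : inner ℝ x y ≤ supportFn A y := by
  obtain ⟨R, hR⟩ := hA.exists_norm_le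
  have hbdd : BddAbove ((fun x => inner ℝ x y) '' A) := by
    refine ⟨R * ‖y‖, ?_⟩
    rintro _ ⟨z, hz, rfl⟩
    exact (real_inner_le_norm z y).trans (mul_le_mul_of_nonneg_right (hR z hz) (norm_nonneg _))
  have hcl : IsClosed {x : E n | inner ℝ x y ≤ supportFn A y} :=
    isClosed_le (by fun_prop) continuous_const
  exact closure_minimal (fun z hz => le_csSup hbdd ⟨z, hz, rfl⟩) hcl hx

/-- Hahn–Banach shows that the half-spaces cut out the closure of `Ω`; an open convex set is the
interior of its closure. -/
theorem wulffDomain_supportFn {Ω : Set (E n)} (ho : IsOpen Ω) (hc : Convex ℝ Ω)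
    (hne : Ω.Nonempty) (hb : Bornology.IsBounded Ω) : wulffDomain (supportFn Ω) = Ω := by
  have h : {x : E n | ∀ ξ : E n, ‖ξ‖ = 1 → inner ℝ x ξ ≤ supportFn Ω ξ} = closure Ω := by
    refine Subset.antisymm (fun x hx => ?_) fun x hx ξ _ => inner_le_supportFn hb hx ξ
    by_contra hxc
    obtain ⟨f, r, hf, hr⟩ := geometric_hahn_banach_closed_point hc.closure isClosed_closure hxc
    set y := (InnerProductSpace.toDual ℝ (E n)).symm f with hy
    have hfy : ∀ z, f z = inner ℝ z y := fun z => by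
      rw [real_inner_comm, hy, InnerProductSpace.toDual_symm_apply]
    have hy0 : 0 < ‖y‖ := by
      rw [norm_pos_iff]
      intro h0
      obtain ⟨z, hz⟩ := hne
      have h1 := hf z (subset_closure hz)
      rw [hfy, h0, inner_zero_right] at h1 hr
      exact lt_asymm h1 hr
    have h1 := hx (‖y‖⁻¹ • y) (by rw [norm_smul, norm_inv, norm_norm, inv_mul_cancel₀ hy0.ne'])
    have h2 : supportFn Ω (‖y‖⁻¹ • y) ≤ ‖y‖⁻¹ * r := by
      refine csSup_le (hne.image _) ?_
      rintro _ ⟨z, hz, rfl⟩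
      simp only [real_inner_smul_right, ← hfy]
      exact mul_le_mul_of_nonneg_left (hf z (subset_closure hz)).le (by positivity)
    rw [real_inner_smul_right, ← hfy] at h1
    have h3 := le_of_mul_le_mul_left (h1.trans h2) (by positivity)
    exact absurd h3 (not_le.2 hr)
  rw [wulffDomain, h, hc.interior_closure_eq_interior_of_nonempty_interior
    (by rwa [ho.interior_eq]), ho.interior_eq]

theorem wulffDomain_const_smul {c : ℝ} (hc : 0 < c) (f : E n → ℝ) :
    wulffDomain (c • f) = c • wulffDomain f := by
  rw [wulffDomain, wulffDomain, ← interior_smul₀ hc.ne']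
  congr 1
  ext x
  rw [mem_smul_set_iff_inv_smul_mem₀ hc.ne']
  simp only [mem_ofPred_eq, real_inner_smul_left, Pi.smul_apply, smul_eq_mul, inv_mul_le_iff₀ hc]

/-- Differentiability of a supremum of linear functions with a continuous choice of maximizers. -/
theorem hasGradientAt_of_isMax {f : E n → ℝ} {X : E n → E n} {ξ : E n} (hX : ContinuousAt X ξ)
    (hf : ∀ᶠ y in 𝓝 ξ, f y = inner ℝ (X y) y)
    (hle : ∀ᶠ y in 𝓝 ξ, ∀ z, inner ℝ (X y) z ≤ f z) : HasGradientAt f (X ξ) ξ := by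
  rw [hasGradientAt_iff_isLittleO, Asymptotics.isLittleO_iff]
  intro ε hε
  filter_upwards [hf, hle, Metric.continuousAt_iff'.1 hX ε hε] with y hfy hley hXy
  have h1 := hle.self_of_nhds y
  have h2 := hley ξ
  have h3 := hf.self_of_nhds
  have h4 : f y - f ξ - inner ℝ (X ξ) (y - ξ) = f y - inner ℝ (X ξ) y := by
    rw [h3, inner_sub_right]
    ring
  -- Maximality at `ξ` makes this difference nonnegative; maximality of `X y` bounds it above by a
  -- product that is `o(‖y - ξ‖)` by continuity of `X`.
  have h5 : f y - inner ℝ (X ξ) y ≤ inner ℝ (X y - X ξ) (y - ξ) := by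
    rw [hfy]
    rw [h3] at h2
    simp only [inner_sub_left, inner_sub_right]
    linarith
  rw [h4, Real.norm_of_nonneg (by linarith)]
  refine (h5.trans (real_inner_le_norm _ _)).trans ?_
  rw [dist_eq_norm] at hXy
  exact mul_le_mul_of_nonneg_right hXy.le (norm_nonneg _)

/-- The inverse Gauss map at `y / ‖y‖` is a continuous choice of the point maximizing `⟨·, y⟩`, so
it is the gradient. -/
theorem IsC2AlphaPlusDomain.gradient_supportFn_mem_frontier {α : ℝ} {Ω : Set (E n)}
    (hΩ : IsC2AlphaPlusDomain α Ω) {ξ : E n} (hξ : ξ ∈ Metric.sphere (0 : E n) 1) :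
    gradient (supportFn Ω) ξ ∈ frontier Ω := by
  obtain ⟨g, ginv, hnormal, -, hinv, hinvOn, -, hsmooth⟩ := hΩ.gauss
  have hmax : ∀ y : E n, y ≠ 0 → ginv (‖y‖⁻¹ • y) ∈ frontier Ω ∧
      supportFn Ω y = inner ℝ (ginv (‖y‖⁻¹ • y)) y := fun y hy => by
    have hy0 : 0 < ‖y‖ := norm_pos_iff.2 hy
    have hsph : ‖y‖⁻¹ • y ∈ Metric.sphere (0 : E n) 1 := by
      rw [mem_sphere_zero_iff_norm, norm_smul, norm_inv, norm_norm, inv_mul_cancel₀ hy0.ne']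
    have hfr := hinv hsph
    have hn : ‖y‖⁻¹ • y ∈ normals Ω (ginv (‖y‖⁻¹ • y)) := by
      rw [hnormal _ hfr, hinvOn.2 hsph]
      rfl
    refine ⟨hfr, le_antisymm (csSup_le (hΩ.nonempty.image _) ?_)
      (inner_le_supportFn hΩ.isBounded (frontier_subset_closure hfr) y)⟩
    rintro _ ⟨z, hz, rfl⟩
    have h1 := hn.2 z hz
    rw [real_inner_smul_right, inner_sub_left] at h1
    have h2 := nonpos_of_mul_nonpos_right h1 (inv_pos.2 hy0)
    simpa using h2
  have hξ1 : ‖ξ‖ = 1 := mem_sphere_zero_iff_norm.1 hξ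
  have hξ0 : ξ ≠ 0 := norm_ne_zero_iff.1 (by rw [hξ1]; exact one_ne_zero)
  have hcont : ContinuousAt (fun y => ginv (‖y‖⁻¹ • y)) ξ := by
    have h1 : ContinuousAt (fun y : E n => ‖y‖⁻¹ • y) ξ :=
      (continuousAt_id.norm.inv₀ (norm_ne_zero_iff.2 hξ0)).smul continuousAt_id
    have h2 : Tendsto (fun y : E n => ‖y‖⁻¹ • y) (𝓝 ξ) (𝓝[Metric.sphere 0 1] ξ) := by
      refine tendsto_nhdsWithin_iff.2 ⟨?_, ?_⟩
      · simpa [ContinuousAt, hξ1] using h1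
      · filter_upwards [isOpen_ne.mem_nhds hξ0] with y hy
        rw [mem_sphere_zero_iff_norm, norm_smul, norm_inv, norm_norm,
          inv_mul_cancel₀ (norm_ne_zero_iff.2 hy)]
    have h3 : Tendsto ginv (𝓝[Metric.sphere 0 1] ξ) (𝓝 (ginv ξ)) :=
      hsmooth.continuousOn ξ hξ
    rw [ContinuousAt, hξ1, inv_one, one_smul]
    exact h3.comp h2
  have hgrad : HasGradientAt (supportFn Ω) (ginv (‖ξ‖⁻¹ • ξ)) ξ := by
    refine hasGradientAt_of_isMax hcont ?_ ?_
    · filter_upwards [isOpen_ne.mem_nhds hξ0] with y hy using (hmax y hy).2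
    · filter_upwards [isOpen_ne.mem_nhds hξ0] with y hy z using
        inner_le_supportFn hΩ.isBounded (frontier_subset_closure (hmax y hy).1) z
  rw [hgrad.gradient]
  exact (hmax ξ hξ0).1

end SupportFunction

/-! ### The dilated solution and its density -/

section Dilation

open scoped Pointwise

theorem frontier_smul₀ {c : ℝ} (hc : c ≠ 0) (s : Set (E n)) :
    frontier (c • s) = c • frontier s :=
  ((Homeomorph.smulOfNeZero c hc).image_frontier s).symm

theorem density_const_smul {α p c : ℝ} (hc : 0 < c) {Ω N : Set (E n)}
    (hΩ : IsC2AlphaPlusDomain α Ω) (hN : IsOpen N) (hΩN : frontier (c • Ω) ⊆ N) {u w : E n → ℝ}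
    (hw : EqOn w (fun x => u (c⁻¹ • x)) (closure (c • Ω ∩ N))) {ξ : E n}
    (hξ : ξ ∈ Metric.sphere (0 : E n) 1) :
    density p w (c • supportFn Ω) ξ = c ^ ((n : ℝ) - p) * density p u (supportFn Ω) ξ := by
  have hx := hΩ.gradient_supportFn_mem_frontier hξ
  set x := gradient (supportFn Ω) ξ with hxdef
  have hwulff := wulffDomain_supportFn hΩ.isOpen hΩ.convex hΩ.nonempty hΩ.isBounded
  have hcx : c • x ∈ frontier (c • Ω) := by
    rw [frontier_smul₀ hc.ne']
    exact smul_mem_smul_set hx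
  have hcl : closure (c • Ω) = c • closure Ω := closure_smul₀ c Ω
  have huniq : UniqueDiffWithinAt ℝ (closure Ω) x := by
    refine uniqueDiffWithinAt_convex hΩ.convex.closure ?_ ?_
    · exact hΩ.nonempty.mono (hΩ.isOpen.subset_interior_iff.2 subset_closure)
    · rw [closure_closure]
      exact frontier_subset_closure hx
  -- A one-sided neighbourhood of the boundary point lies in `closure (c • Ω ∩ N)`, so agreement
  -- there determines the gradient.
  have heq : w =ᶠ[𝓝[closure (c • Ω)] (c • x)] fun y => u (c⁻¹ • y) := by
    filter_upwards [inter_mem_nhdsWithin _ (hN.mem_nhds (hΩN hcx))] with y hy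
    refine hw ?_
    have := hN.inter_closure (t := c • Ω) ⟨hy.2, hy.1⟩
    rwa [inter_comm] at this
  have hgrad : gradientWithin w (closure (c • Ω)) (c • x) =
      c⁻¹ • gradientWithin u (closure Ω) x := by
    rw [gradientWithin, heq.fderivWithin_eq (heq.self_of_nhdsWithin
      (frontier_subset_closure hcx)), ← gradientWithin, hcl,
      gradientWithin_comp_inv_smul hc.ne' u huniq]
  have hfin := finrank_orthogonal_span_singleton_of_norm_eq_one (mem_sphere_zero_iff_norm.1 hξ)
  -- The exponents add up as `-(p - 1) + (n - 1) = n - p`.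
  have hpow : c ^ ((n : ℝ) - p) =
      (c⁻¹) ^ (p - 1) * c ^ Module.finrank ℝ (ℝ ∙ ξ)ᗮ := by
    rw [← Real.rpow_natCast, Real.inv_rpow hc.le, ← Real.rpow_neg hc.le, ← Real.rpow_add hc]
    congr 1
    have : ((Module.finrank ℝ (ℝ ∙ ξ)ᗮ : ℕ) : ℝ) + 1 = n := by exact_mod_cast hfin
    linarith
  rw [density, density, wulffDomain_const_smul hc, hwulff, gradient_const_smul, ← hxdef, hgrad,
    detHess_const_smul, norm_smul, Real.norm_of_nonneg (by positivity),
    Real.mul_rpow (by positivity) (norm_nonneg _), hpow]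
  ring

/-- Each property is an inclusion of a compact set in an open one, which survives a small
thickening, and dilation moves points of `closure Ω` by at most `|t| R`. -/
theorem exists_forall_abs_le_dilation {Ω N N₀ : Set (E n)} (hΩ : IsOpen Ω)
    (hb : Bornology.IsBounded Ω) (hN : IsOpen N) (hN₀ : IsOpen N₀) (hΩN : frontier Ω ⊆ N)
    (hNN₀ : closure N ⊆ N₀) :
    ∃ τ : ℝ, 0 < τ ∧ τ < 1 ∧ ∀ t : ℝ, |t| ≤ τ →
      frontier ((1 + t) • Ω) ⊆ N ∧
      frontier N ∩ (1 + t) • Ω = frontier N ∩ Ω ∧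
      ∀ x ∈ closure ((1 + t) • Ω) ∩ closure N, (1 + t)⁻¹ • x ∈ N₀ := by
  have hcΩ : IsCompact (closure Ω) := hb.isCompact_closure
  have hNfr : ∀ x ∈ frontier N, x ∉ N := fun x hx hxN => by
    rw [hN.frontier_eq] at hx
    exact hx.2 hxN
  have hclΩ : ∀ x ∈ closure Ω, x ∈ Ω ∨ x ∈ N := fun x hx => by
    by_cases h : x ∈ Ω
    · exact Or.inl h
    · exact Or.inr (hΩN (by rw [hΩ.frontier_eq]; exact ⟨hx, h⟩))
  obtain ⟨R, hR0, hR⟩ := hcΩ.isBounded.exists_pos_norm_le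
  obtain ⟨δ₁, hδ₁, h₁⟩ := (hcΩ.of_isClosed_subset isClosed_frontier
    frontier_subset_closure).exists_cthickening_subset_open hN hΩN
  obtain ⟨δ₂, hδ₂, h₂⟩ := hcΩ.exists_cthickening_subset_open (hΩ.union hN) hclΩ
  obtain ⟨δ₃, hδ₃, h₃⟩ := (hcΩ.inter_left (isClosed_frontier (s := N))).exists_cthickening_subset_open
    hΩ fun x hx => (hclΩ x hx.2).resolve_right (hNfr x hx.1)
  obtain ⟨δ₄, hδ₄, h₄⟩ := ((isCompact_closedBall (0 : E n) (2 * R)).inter_left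
    (isClosed_closure (s := N))).exists_cthickening_subset_open hN₀
    (inter_subset_left.trans hNN₀)
  set δ := min (min δ₁ δ₂) (min δ₃ δ₄) with hδ
  have hδ0 : 0 < δ := lt_min (lt_min hδ₁ hδ₂) (lt_min hδ₃ hδ₄)
  have hδ1 : δ ≤ δ₁ := (min_le_left _ _).trans (min_le_left _ _)
  have hδ2 : δ ≤ δ₂ := (min_le_left _ _).trans (min_le_right _ _)
  have hδ3 : δ ≤ δ₃ := (min_le_right _ _).trans (min_le_left _ _)
  have hδ4 : δ ≤ δ₄ := (min_le_right _ _).trans (min_le_right _ _)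
  -- For `|t| ≤ 1 / 2` both `1 + t` and its inverse are at most `2`, whence the factor `2 * R`.
  refine ⟨min (1 / 2) (δ / (2 * R)), by positivity, (min_le_left _ _).trans_lt (by norm_num),
    fun t ht => ?_⟩
  have ht1 : |t| ≤ 1 / 2 := ht.trans (min_le_left _ _)
  have ht2 : |t| * (2 * R) ≤ δ := (le_div_iff₀ (by positivity)).1 (ht.trans (min_le_right _ _))
  have ht3 := abs_le.1 ht1
  have hc : 0 < 1 + t := by linarith
  have hdist : ∀ y ∈ closure Ω, dist ((1 + t) • y) y ≤ δ := fun y hy => by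
    rw [dist_eq_norm, add_smul, one_smul, add_sub_cancel_left, norm_smul, Real.norm_eq_abs]
    have := mul_le_mul_of_nonneg_left (hR y hy) (abs_nonneg t)
    nlinarith [abs_nonneg t]
  refine ⟨?_, Subset.antisymm ?_ ?_, ?_⟩
  · rw [frontier_smul₀ hc.ne']
    rintro _ ⟨y, hy, rfl⟩
    exact h₁ (Metric.mem_cthickening_of_dist_le _ y _ _ hy
      ((hdist y (frontier_subset_closure hy)).trans hδ1))
  · rintro _ ⟨hx, y, hy, rfl⟩
    exact ⟨hx, (h₂ (Metric.mem_cthickening_of_dist_le _ y _ _ (subset_closure hy)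
      ((hdist y (subset_closure hy)).trans hδ2))).resolve_right (hNfr _ hx)⟩
  · rintro x ⟨hx, hxΩ⟩
    refine ⟨hx, (mem_smul_set_iff_inv_smul_mem₀ hc.ne' _ _).2 (h₃
      (Metric.mem_cthickening_of_dist_le _ x _ _ ⟨hx, subset_closure hxΩ⟩ (le_trans ?_ hδ3)))⟩
    have h5 : (1 + t)⁻¹ • x - x = -((1 + t)⁻¹ * t) • x := by
      rw [show -((1 + t)⁻¹ * t) = (1 + t)⁻¹ - 1 by field_simp; ring, sub_smul, one_smul]
    have h6 : (1 + t)⁻¹ ≤ 2 := by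
      rw [inv_le_comm₀ hc two_pos]
      linarith
    rw [dist_eq_norm, h5, norm_smul, norm_neg, norm_mul, Real.norm_eq_abs, Real.norm_eq_abs,
      abs_of_pos (inv_pos.2 hc)]
    calc (1 + t)⁻¹ * |t| * ‖x‖ ≤ 2 * |t| * R := by
          gcongr
          exact hR x (subset_closure hxΩ)
      _ = |t| * (2 * R) := by ring
      _ ≤ δ := ht2
  · rintro x ⟨hx, hxN⟩
    rw [closure_smul₀] at hx
    obtain ⟨y, hy, rfl⟩ := hx
    simp only [inv_smul_smul₀ hc.ne'] at hxN ⊢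
    refine h₄ (Metric.mem_cthickening_of_dist_le _ ((1 + t) • y) _ _ ⟨hxN, ?_⟩
      (by rw [dist_comm]; exact (hdist y hy).trans hδ4))
    rw [mem_closedBall_zero_iff, norm_smul, Real.norm_of_nonneg hc.le]
    exact mul_le_mul (by linarith) (hR y hy) (norm_nonneg _) two_pos.le

theorem isDirichletSolution_dilation {p c : ℝ} (hc : 0 < c) {Ω N N₀ : Set (E n)}
    {f u : E n → ℝ} {t : ℝ} (htc : 1 + t = c) (hf : wulffDomain f = c • Ω) (hΩ : IsOpen Ω)
    (hN₀ : IsOpen N₀) (hu : IsPotential p Ω N₀ u)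
    (hmaps : ∀ x ∈ closure (c • Ω) ∩ closure N, c⁻¹ • x ∈ N₀) :
    IsDirichletSolution p N u f t fun x => u (c⁻¹ • x) := by
  have hcl : closure (c • Ω ∩ N) ⊆ closure (c • Ω) ∩ closure N :=
    closure_inter_subset_inter_closure _ _
  refine ⟨?_, ?_, fun x hx => ?_, fun x hx => by rw [htc]⟩
  · rw [hf]
    refine (hu.pharmonic.comp_inv_smul hc (hΩ.inter hN₀).measurableSet).mono
      ((hΩ.inter hN₀).smul₀ hc.ne').measurableSet fun x hx => ?_
    rw [mem_smul_set_iff_inv_smul_mem₀ hc.ne']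
    exact ⟨(mem_smul_set_iff_inv_smul_mem₀ hc.ne' _ _).1 hx.1,
      hmaps x ⟨subset_closure hx.1, subset_closure hx.2⟩⟩
  · rw [hf]
    refine hu.continuousOn.comp (continuous_const_smul _).continuousOn fun x hx => ?_
    refine ⟨?_, hmaps x (hcl hx)⟩
    have := (hcl hx).1
    rwa [closure_smul₀, mem_smul_set_iff_inv_smul_mem₀ hc.ne'] at this
  · rw [hf, frontier_smul₀ hc.ne'] at hx
    exact hu.zero _ ((mem_smul_set_iff_inv_smul_mem₀ hc.ne' _ _).1 hx.1)

theorem IsDirichletSolution.eqOn (hn : 1 ≤ n) {p : ℝ} (hp : 1 < p) {N : Set (E n)} (hN : IsOpen N)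
    {f u : E n → ℝ} {t : ℝ} (hb : Bornology.IsBounded (wulffDomain f))
    (hfr : frontier (wulffDomain f) ⊆ N) {w₁ w₂ : E n → ℝ}
    (h₁ : IsDirichletSolution p N u f t w₁) (h₂ : IsDirichletSolution p N u f t w₂) :
    EqOn w₁ w₂ (closure (wulffDomain f ∩ N)) := by
  have ho : IsOpen (wulffDomain f) := isOpen_interior
  refine h₁.pharmonic.eqOn_closure hn hp (ho.inter hN) (hb.subset inter_subset_left) h₂.pharmonic
    h₁.continuousOn h₂.continuousOn fun x hx => ?_
  -- A frontier point of the intersection lies on `∂Ω^t`, where both solutions vanish, or on `∂N`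
  -- inside `Ω^t`, where both take the outer data.
  by_cases hxf : x ∈ frontier (wulffDomain f)
  · rw [h₁.zero x ⟨hxf, hfr hxf⟩, h₂.zero x ⟨hxf, hfr hxf⟩]
  · rcases frontier_inter_subset _ _ hx with h | h
    · exact absurd h.1 hxf
    · have hxo : x ∈ wulffDomain f := by
        by_contra hxn
        exact hxf (by rw [ho.frontier_eq]; exact ⟨h.1, hxn⟩)
      rw [h₁.outer x ⟨h.2, hxo⟩, h₂.outer x ⟨h.2, hxo⟩]

end Dilation

end PHarmonicMinkowski
-- Homogeneity and the first variation
theorem mainTheorem10 (n : ℕ) (hn : 2 ≤ n) (p : ℝ) (hp : 1 < p)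
    (α : ℝ) (hα : 0 < α) (hα1 : α ≤ 1)
    (Ω : Set (E n)) (hΩ : IsC2AlphaPlusDomain α Ω)
    (N₀ N : Set (E n)) (hN₀ : IsOpen N₀) (hN : IsOpen N)
    (hΩN : frontier Ω ⊆ N) (hNN₀ : closure N ⊆ N₀)
    (u : E n → ℝ) (hu : IsPotential p Ω N₀ u)
    (h : E n → ℝ) (hh : h = supportFn Ω) :
    (∃ τ : ℝ, 0 < τ ∧ τ < 1 ∧ ∀ t : ℝ, |t| ≤ τ →
      frontier (wulffDomain (h + t • h)) ⊆ N ∧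
      frontier N ∩ wulffDomain (h + t • h) = frontier N ∩ Ω ∧
      (∃ w, IsDirichletSolution p N u (h + t • h) t w) ∧
      ∀ w, IsDirichletSolution p N u (h + t • h) t w →
        ∀ ξ ∈ Metric.sphere (0 : E n) 1,
          density p w ((1 + t) • h) ξ = (1 + t) ^ ((n : ℝ) - p) * density p u h ξ) ∧
    (∀ U : ℝ → E n → ℝ,
      (∀ᶠ t in 𝓝 (0 : ℝ), IsDirichletSolution p N u (h + t • h) t (U t)) →
        ∀ ξ ∈ Metric.sphere (0 : E n) 1,
          DifferentiableAt ℝ (fun t : ℝ => density p (U t) (h + t • h) ξ) 0 ∧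
          firstVariation p U h h ξ = ((n : ℝ) - p) * density p u h ξ) := by

  obtain ⟨τ, hτ0, hτ1, hτ⟩ :=
    exists_forall_abs_le_dilation hΩ.isOpen hΩ.isBounded hN hN₀ hΩN hNN₀
  have hwulff : wulffDomain h = Ω := by
    rw [hh, wulffDomain_supportFn hΩ.isOpen hΩ.convex hΩ.nonempty hΩ.isBounded]
  have hadd : ∀ t : ℝ, h + t • h = (1 + t) • h := fun t => by rw [add_smul, one_smul]
  have hpos : ∀ t : ℝ, |t| ≤ τ → 0 < 1 + t := fun t ht => by linarith [(abs_le.1 ht).1]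
  open scoped Pointwise in
  have hdom : ∀ t : ℝ, |t| ≤ τ → wulffDomain (h + t • h) = (1 + t) • Ω := fun t ht => by
    rw [hadd, wulffDomain_const_smul (hpos t ht), hwulff]
  have hsol : ∀ t : ℝ, |t| ≤ τ →
      IsDirichletSolution p N u (h + t • h) t fun x => u ((1 + t)⁻¹ • x) := fun t ht =>
    isDirichletSolution_dilation (hpos t ht) rfl (hdom t ht) hΩ.isOpen hN₀ hu (hτ t ht).2.2
  have hfr : ∀ t : ℝ, |t| ≤ τ → frontier (wulffDomain (h + t • h)) ⊆ N := fun t ht => by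
    rw [hdom t ht]
    exact (hτ t ht).1
  have hdens : ∀ t : ℝ, |t| ≤ τ → ∀ w, IsDirichletSolution p N u (h + t • h) t w →
      ∀ ξ ∈ Metric.sphere (0 : E n) 1,
        density p w ((1 + t) • h) ξ = (1 + t) ^ ((n : ℝ) - p) * density p u h ξ := by
    intro t ht w hw ξ hξ
    have hb : Bornology.IsBounded (wulffDomain (h + t • h)) := by
      rw [hdom t ht]
      exact hΩ.isBounded.smul₀ (1 + t)
    have heq := hw.eqOn (by omega) hp hN hb (hfr t ht) (hsol t ht)
    rw [hdom t ht] at heq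
    rw [hh]
    exact density_const_smul (hpos t ht) hΩ hN (hτ t ht).1 heq hξ
  refine ⟨⟨τ, hτ0, hτ1, fun t ht => ⟨hfr t ht, ?_, ⟨_, hsol t ht⟩, hdens t ht⟩⟩, ?_⟩
  · rw [hdom t ht]
    exact (hτ t ht).2.1
  · intro U hU ξ hξ
    -- The neighbourhood includes `t = 0`, so the values agree there too, as the transfer of the
    -- derivative requires.
    have hev : (fun t : ℝ => density p (U t) (h + t • h) ξ) =ᶠ[𝓝 0]
        fun t => (1 + t) ^ ((n : ℝ) - p) * density p u h ξ := by
      filter_upwards [hU, Metric.closedBall_mem_nhds (0 : ℝ) hτ0] with t ht htτ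
      rw [mem_closedBall_zero_iff, Real.norm_eq_abs] at htτ
      rw [← hdens t htτ (U t) ht ξ hξ, hadd]
    have hder : HasDerivAt (fun t : ℝ => (1 + t) ^ ((n : ℝ) - p) * density p u h ξ)
        (((n : ℝ) - p) * density p u h ξ) 0 := by
      have h1 : HasDerivAt (fun t : ℝ => 1 + t) 1 0 := (hasDerivAt_id (0 : ℝ)).const_add 1
      -- The base equals `1` at `t = 0`, so the power rule holds for every real exponent, including
      -- `n - p < 1`.
      have h2 := (h1.rpow_const (p := (n : ℝ) - p) (Or.inl (by norm_num))).mul_const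
        (density p u h ξ)
      simpa using h2
    have hder' := hder.congr_of_eventuallyEq hev
    exact ⟨hder'.differentiableAt, hder'.deriv⟩
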